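/- Consider a binary contextuality scenario: a set $\mathcal M$ of measurements, a common set $\mathcal O$ of outcomes, and a family of jointly measurable subsets of $\mathcal M$, each having at most two elements. In each run two measurements are selected by random variables $X,Y$ with values in $\mathcal M$ such that $\{X,Y\}$ is always jointly measurable, and outcomes are recorded by random variables $A,B$ with values in $\mathcal O$. A phenomenon is a (discrete) probability distribution $\mathcal P(ABXY)$. It satisfies no-disturbance if $\mathcal P(A|XY)=\mathcal P(A|X)$ and $\mathcal P(B|XY)=\mathcal P(B|Y)$ for all values for which these conditionals are defined. A causal model for $\mathcal P$ consists of a finite (possibly empty) collection $\Lambda$ of discrete latent variables, a directed acyclic graph $\mathcal G$ with nodes $A,B,X,Y$ and the latent variables, and a joint distribution $P(ABXY\Lambda)$ which is compatible with $\mathcal G$, i.e. equal to the product over all nodes of the probability of the node given its parents, and which has marginal $\mathcal P(ABXY)$. The model is faithful (satisfies no fine-tuning) if, for all pairwise disjoint sets $C,D,E$ of observable variables such that $C$ and $D$ are conditionally independent given $E$ in $\mathcal P$, the sets $C$ and $D$ are d-separated by $E$ in $\mathcal G$. A causal model is factorisable if $$P(AB|XY)=\sum_{\Lambda}P(\Lambda)\,P(A|X\Lambda)\,P(B|Y\Lambda)$$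 for all values of $A,B,X,Y$ for which the left-hand side is defined, and $\mathcal P$ is KS-noncontextual if some causal model for $\mathcal P$ is factorisable. **Theorem.** If a phenomenon in a binary contextuality scenario satisfies no-disturbance and has a faithful causal model, then it is KS-noncontextual. -/

import Mathlib

open scoped ENNReal

universe u

/-! ### Discrete random variables: events, conditional probability, conditional independence -/

section Probability

/-- The probability of an event under a discrete distribution. -/
noncomputable def prob {Ω : Type*} (p : PMF Ω) (E : Set Ω) : ℝ≥0∞ :=
  p.toOuterMeasure E

/-- The conditional probability `P(E | F)`; it is only meaningful if `prob p F ≠ 0`, and it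
is `0` otherwise. -/
noncomputable def condProb {Ω : Type*} (p : PMF Ω) (E F : Set Ω) : ℝ≥0∞ :=
  prob p (E ∩ F) / prob p F

/-- The event that all the variables in `C` take the values prescribed by `x`. -/
def cyl {V : Type*} {α : V → Type*} (C : Set V) (x : ∀ v, α v) : Set (∀ v, α v) :=
  {ω | ∀ v ∈ C, ω v = x v}

/-- Conditional independence `(C ⫫ D | E)` of sets of variables: `P(C | D, E) = P(C | E)` for
all values for which the conditionals are defined. -/
def CondIndep {V : Type*} {α : V → Type*} (p : PMF (∀ v, α v)) (C D E : Set V) : Prop :=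
  ∀ x : ∀ v, α v, prob p (cyl (D ∪ E) x) ≠ 0 →
    condProb p (cyl C x) (cyl (D ∪ E) x) = condProb p (cyl C x) (cyl E x)

end Probability

/-! ### Directed acyclic graphs, compatibility and d-separation -/

namespace Digraph

variable {V : Type*}

/-- There are no directed cycles. -/
def IsAcyclic (G : Digraph V) : Prop :=
  ∀ v, ¬ Relation.TransGen G.Adj v v

/-- The parents (direct causes) of a node. -/
def parents (G : Digraph V) (v : V) : Set V :=
  {w | G.Adj w v}

/-- The distribution `p` is compatible with `G`: it factorises as
`P(x₁, …, xₙ) = ∏ⱼ P(xⱼ | pa(xⱼ))`. -/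
def Compatible [Fintype V] {α : V → Type*} (G : Digraph V) (p : PMF (∀ v, α v)) : Prop :=
  ∀ x : ∀ v, α v, p x = ∏ v, condProb p (cyl {v} x) (cyl (G.parents v) x)

/-- `p` is a path from `c` to `d`: a sequence of distinct nodes, consecutive ones being joined
by an edge in either direction. -/
def IsPath (G : Digraph V) (c d : V) (p : List V) : Prop :=
  p.head? = some c ∧ p.getLast? = some d ∧ p.Nodup ∧
    p.IsChain (fun u v => G.Adj u v ∨ G.Adj v u)

/-- The path `p` is blocked by `Z`: it contains a chain or a fork whose middle node is in `Z`, or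
an inverted fork whose middle node is not in `Z` and has no directed path to a member of `Z`. -/
def Blocked (G : Digraph V) (Z : Set V) (p : List V) : Prop :=
  ∃ u v w, [u, v, w] <:+: p ∧
    (((G.Adj u v ∧ G.Adj v w) ∨ (G.Adj w v ∧ G.Adj v u) ∨ (G.Adj v u ∧ G.Adj v w)) ∧ v ∈ Z ∨
      (G.Adj u v ∧ G.Adj w v) ∧ v ∉ Z ∧ ∀ z ∈ Z, ¬ Relation.TransGen G.Adj v z)

/-- d-separation `(C ⫫ D | E)_d`: every path from `C` to `D` is blocked by `E`. -/
def DSep (G : Digraph V) (C D E : Set V) : Prop :=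
  ∀ c ∈ C, ∀ d ∈ D, ∀ p : List V, G.IsPath c d p → G.Blocked E p

end Digraph

/-! ### Binary contextuality scenarios, phenomena and causal models -/

/-- The four observable variables: outcomes `A`, `B` and settings `X`, `Y`. -/
inductive Obs
  | A
  | B
  | X
  | Y
  deriving DecidableEq

instance : Fintype Obs :=
  ⟨{.A, .B, .X, .Y}, by rintro (_ | _ | _ | _) <;> simp⟩

/-- The value type of an observable variable: outcomes for `A`, `B`, measurements for `X`, `Y`. -/
def ObsVal (M O : Type u) : Obs → Type u
  | .A => O
  | .B => O
  | .X => M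
  | .Y => M

/-- A measurement scenario with measurements `M`, outcomes `O` and a compatibility structure (the
family of jointly measurable sets) which only contains sets of at most two measurements. -/
structure BinaryScenario (M O : Type u) where
  contexts : Set (Set M)
  binary : ∀ c ∈ contexts, c.encard ≤ 2

/-- A phenomenon in a binary contextuality scenario: a distribution of `A, B, X, Y` such that in
each run the measurements selected by `X` and `Y` are jointly measurable. -/
structure Phenomenon {M O : Type u} (S : BinaryScenario M O) where
  dist : PMF (∀ v, ObsVal M O v)
  compatible : ∀ o ∈ dist.support, ({o Obs.X, o Obs.Y} : Set M) ∈ S.contexts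

/-- No-disturbance: `P(A | X, Y) = P(A | X)` and `P(B | X, Y) = P(B | Y)` whenever the conditionals
are defined. -/
def Phenomenon.NoDisturbance {M O : Type u} {S : BinaryScenario M O}
    (P : Phenomenon S) : Prop :=
  ∀ o : ∀ v, ObsVal M O v, prob P.dist (cyl {Obs.X, Obs.Y} o) ≠ 0 →
    condProb P.dist (cyl {Obs.A} o) (cyl {Obs.X, Obs.Y} o) =
        condProb P.dist (cyl {Obs.A} o) (cyl {Obs.X} o) ∧
      condProb P.dist (cyl {Obs.B} o) (cyl {Obs.X, Obs.Y} o) =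
        condProb P.dist (cyl {Obs.B} o) (cyl {Obs.Y} o)

/-- The value types of all variables of a causal model: observable and latent ones. -/
abbrev NodeVal (M O : Type u) {L : Type} (LatentVal : L → Type u) : Obs ⊕ L → Type u :=
  Sum.elim (ObsVal M O) LatentVal

/-- A causal model for the phenomenon `P`: a finite, possibly empty, set of latent variables, a DAG
on the observable and latent variables, and a joint distribution that is compatible with the DAG
and whose marginal on the observable variables is `P`. -/
structure CausalModel {M O : Type u} {S : BinaryScenario M O} (P : Phenomenon S) where
  Latent : Type
  [fintypeLatent : Fintype Latent]
  LatentVal : Latent → Type u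
  graph : Digraph (Obs ⊕ Latent)
  acyclic : graph.IsAcyclic
  joint : PMF (∀ v, NodeVal M O LatentVal v)
  compatible : graph.Compatible joint
  marginal : joint.map (fun ω v => ω (Sum.inl v)) = P.dist

attribute [instance] CausalModel.fintypeLatent

namespace CausalModel

variable {M O : Type u} {S : BinaryScenario M O} {P : Phenomenon S}

/-- Faithfulness (no fine-tuning): every conditional independence between disjoint sets of
observable variables that holds in the phenomenon corresponds to a d-separation in the graph. -/
def Faithful (Γ : CausalModel P) : Prop :=
  ∀ C D E : Set Obs, Disjoint C D → Disjoint C E → Disjoint D E →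
    CondIndep P.dist C D E → Γ.graph.DSep (Sum.inl '' C) (Sum.inl '' D) (Sum.inl '' E)

/-- The event that the observable variables in `C` take the values prescribed by `o`. -/
def obsEvent (Γ : CausalModel P) (C : Set Obs) (o : ∀ v, ObsVal M O v) :
    Set (∀ v, NodeVal M O Γ.LatentVal v) :=
  {ω | ∀ v ∈ C, ω (Sum.inl v) = o v}

/-- The event that the latent variables take the values `l`. -/
def latentEvent (Γ : CausalModel P) (l : ∀ i, Γ.LatentVal i) :
    Set (∀ v, NodeVal M O Γ.LatentVal v) :=
  {ω | ∀ i, ω (Sum.inr i) = l i}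

/-- Factorisability: `P(A, B | X, Y) = ∑_Λ P(Λ) P(A | X, Λ) P(B | Y, Λ)` whenever the left-hand side
is defined, where `Λ` is the collection of all latent variables of the model. (The equation for
all outcomes forces the conditionals on the right to be defined for all `Λ` with `P(Λ) ≠ 0`, as
both sides have to add up to `1` over the outcomes.) -/
def Factorisable (Γ : CausalModel P) : Prop :=
  ∀ o : ∀ v, ObsVal M O v, prob Γ.joint (Γ.obsEvent {Obs.X, Obs.Y} o) ≠ 0 →
    condProb Γ.joint (Γ.obsEvent {Obs.A, Obs.B} o) (Γ.obsEvent {Obs.X, Obs.Y} o) =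
      ∑' l : ∀ i, Γ.LatentVal i, prob Γ.joint (Γ.latentEvent l) *
        condProb Γ.joint (Γ.obsEvent {Obs.A} o) (Γ.obsEvent {Obs.X} o ∩ Γ.latentEvent l) *
        condProb Γ.joint (Γ.obsEvent {Obs.B} o) (Γ.obsEvent {Obs.Y} o ∩ Γ.latentEvent l)

end CausalModel

/-- The phenomenon is KS-noncontextual: it is reproduced by some factorisable causal model. -/
def Phenomenon.KSNoncontextual {M O : Type u} {S : BinaryScenario M O}
    (P : Phenomenon S) : Prop :=
  ∃ Γ : CausalModel P, Γ.Factorisable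

/-! No-disturbance says that A is independent of Y given X, and B of X given Y; faithfulness turns
these into d-separations. Let D be the set of common ancestors of A and B that are not ancestors of
X or Y. A parent of a node of D that is an ancestor of a setting would be connected to A given X and
to B given Y; descending from it to a setting contradicts one of the d-separations
(`not_mem_conn_both`). Hence D is ancestral (`isAncestral_common`) and disjoint from the ancestors
of X and Y, so it is independent of the settings (`Compatible.prob_cyl_union`).

The d-separations also force each family (a node with its parents) among the ancestors of the
observables to lie in A's wing with D and X, to lie in B's wing with D and Y, or to avoid both wings
(`family_cases`). Summing the Markov product over all other nodes leaves f(D,X,A) g(D,Y,B) r(D,X,Y)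
(`Compatible.exists_factors`), which equals P(D,X,Y) P(A|D,X) P(B|D,Y) (`prob_eq_mul_condProb`).

Finally D becomes a single latent variable of a Bell graph (`ksNoncontextual_of_latent`). It may
contain A or B; its value then carries a copy of that outcome. -/

/-! ### Part: d-separation through walks instead of paths. -/

namespace Digraph

variable {V : Type*} {G : Digraph V} {Z : Set V} {c d : V}

theorem Blocked.reverse {p : List V} (h : G.Blocked Z p) : G.Blocked Z p.reverse := by
  obtain ⟨u, v, w, hi, h⟩ := h
  refine ⟨w, v, u, by simpa using List.reverse_infix.2 hi, ?_⟩
  rcases h with ⟨h, hz⟩ | ⟨⟨h₁, h₂⟩, hz⟩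
  · exact Or.inl ⟨by tauto, hz⟩
  · exact Or.inr ⟨⟨h₂, h₁⟩, hz⟩

theorem Blocked.mono {p q : List V} (h : G.Blocked Z p) (hpq : p <:+: q) : G.Blocked Z q := by
  obtain ⟨u, v, w, hi, h⟩ := h
  exact ⟨u, v, w, hi.trans hpq, h⟩

/-- Following an outgoing edge along an unblocked walk, one either arrives at the end through
forward edges only, or meets a collider with a descendant in `Z`. -/
theorem transGen_of_not_blocked {v : V} (l : List V) :
    ∀ u n, G.Adj u n → (u :: n :: l).IsChain (fun a b => G.Adj a b ∨ G.Adj b a) →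
      ¬ G.Blocked Z (u :: n :: l) → (u :: n :: l).getLast? = some v →
      Relation.TransGen G.Adj u v ∨ ∃ z ∈ Z, Relation.TransGen G.Adj u z := by
  induction l with
  | nil =>
    intro u n hun _ _ hv
    simp at hv
    subst hv
    exact Or.inl (.single hun)
  | cons m l ih =>
    intro u n hun hc hb hv
    rw [List.isChain_cons_cons] at hc
    have hc' := hc.2
    rw [List.isChain_cons_cons] at hc'
    have hb' : ¬ G.Blocked Z (n :: m :: l) := fun h =>
      hb (h.mono (List.suffix_cons _ _).isInfix)
    rcases hc'.1 with h | h
    · rcases ih n m h hc.2 hb' (by simpa [List.getLast?_cons_cons] using hv) with h | ⟨z, hz, h⟩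
      · exact Or.inl (.head hun h)
      · exact Or.inr ⟨z, hz, .head hun h⟩
    -- Now `n` is a collider, and it is open only if it or a descendant of it lies in `Z`.
    · by_cases hn : n ∈ Z
      · exact Or.inr ⟨n, hn, .single hun⟩
      · by_contra hcon
        push Not at hcon
        refine hb ⟨u, n, m, ⟨[], l, by simp⟩, Or.inr ⟨⟨hun, h⟩, hn, fun z hz hnz => ?_⟩⟩
        exact hcon.2 z hz (.head hun hnz)

theorem infix_triple_cases {u v w x : V} {l₁ l₃ : List V} (h : [u, v, w] <:+: l₁ ++ x :: l₃) :
    [u, v, w] <:+: l₁ ++ [x] ∨ [u, v, w] <:+: x :: l₃ ∨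
      v = x ∧ (∃ l, l₁ = l ++ [u]) ∧ ∃ l, l₃ = w :: l := by
  induction l₁ with
  | nil => exact Or.inr (Or.inl h)
  | cons a l₁ ih =>
    rw [List.cons_append, List.infix_cons_iff] at h
    rcases h with h | h
    · match l₁, h with
      | [], h =>
        match l₃, h with
        | [], h => simp at h
        | b :: l₃, h =>
          simp at h
          obtain ⟨rfl, rfl, rfl⟩ := h
          exact Or.inr (Or.inr ⟨rfl, ⟨[], rfl⟩, ⟨l₃, rfl⟩⟩)
      | [b], h =>
        simp at h
        obtain ⟨rfl, rfl, rfl⟩ := h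
        exact Or.inl ⟨[], [], by simp⟩
      | b :: e :: l, h =>
        simp at h
        obtain ⟨rfl, rfl, rfl⟩ := h
        exact Or.inl ⟨[], l ++ [x], by simp⟩
    · rcases ih h with h | h | ⟨h, ⟨l, hl⟩, h'⟩
      · exact Or.inl (h.trans (List.suffix_cons _ _).isInfix)
      · exact Or.inr (Or.inl h)
      · exact Or.inr (Or.inr ⟨h, ⟨a :: l, by simp [hl]⟩, h'⟩)

/-- Erasing a loop from an unblocked walk gives an unblocked walk. -/
theorem not_blocked_erase_loop (hG : G.IsAcyclic) {v : V} {l₁ l₂ l₃ : List V}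
    (hc : (l₁ ++ v :: (l₂ ++ v :: l₃)).IsChain (fun a b => G.Adj a b ∨ G.Adj b a))
    (hb : ¬ G.Blocked Z (l₁ ++ v :: (l₂ ++ v :: l₃))) : ¬ G.Blocked Z (l₁ ++ v :: l₃) := by
  rintro ⟨a, v', e, hi, h⟩
  rcases infix_triple_cases hi with hi | hi | ⟨rfl, ⟨l, rfl⟩, ⟨l', rfl⟩⟩
  · exact hb ⟨a, v', e, hi.trans ⟨[], l₂ ++ v :: l₃, by simp⟩, h⟩
  · exact hb ⟨a, v', e, hi.trans ⟨l₁ ++ v :: l₂, [], by simp⟩, h⟩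
  -- Only the triple at the splice is new. Here `n` follows the first occurrence of `v'` and `m`
  -- precedes the second; both are `v'` if the loop has no inner node.
  obtain ⟨n, l₂', hn⟩ : ∃ n l, l₂ ++ v' :: e :: l' = n :: l := by
    cases l₂ with
    | nil => exact ⟨_, _, rfl⟩
    | cons b l₂ => exact ⟨_, _, rfl⟩
  obtain ⟨m, l₀, hm⟩ : ∃ m l₀, v' :: l₂ = l₀ ++ [m] :=
    ⟨_, _, (List.dropLast_append_getLast (List.cons_ne_nil v' l₂)).symm⟩
  have hin : [a, v', n] <:+: l ++ [a] ++ v' :: (l₂ ++ v' :: e :: l') :=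
    ⟨l, l₂', by simp [hn]⟩
  have him : [m, v', e] <:+: l ++ [a] ++ v' :: (l₂ ++ v' :: e :: l') := by
    refine ⟨l ++ [a] ++ l₀, l', ?_⟩
    have : v' :: (l₂ ++ v' :: e :: l') = l₀ ++ [m] ++ v' :: e :: l' := by
      rw [← hm]; simp
    rw [this]; simp
  have hvn : G.Adj v' n ∨ G.Adj n v' := by
    have := (List.isChain_append.1 hc).2.1
    rw [hn, List.isChain_cons_cons] at this
    exact this.1
  have hmv : G.Adj m v' ∨ G.Adj v' m := by
    have h2 : List.IsChain (fun a b => G.Adj a b ∨ G.Adj b a) [m, v', e] := hc.infix him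
    simp at h2
    exact h2.1
  rcases h with ⟨h, hz⟩ | ⟨⟨hav, hev⟩, hz, hd⟩
  -- A chain or fork has an edge leaving `v'`, towards `a` or `e`. The original triple containing
  -- that edge is also a non-collider, hence blocked.
  · by_cases hva : G.Adj v' a
    · refine hb ⟨a, v', n, hin, Or.inl ⟨?_, hz⟩⟩
      tauto
    · have hve : G.Adj v' e := by tauto
      refine hb ⟨m, v', e, him, Or.inl ⟨?_, hz⟩⟩
      tauto
  -- If the loop leaves `v'` forwards, following it gives a directed cycle or a descendant of `v'`
  -- in `Z`; otherwise the first occurrence of `v'` was already a blocked collider.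
  · rcases hvn with hvn | hvn
    · have hsub : v' :: (l₂ ++ [v']) <:+: l ++ [a] ++ v' :: (l₂ ++ v' :: e :: l') :=
        ⟨l ++ [a], e :: l', by simp⟩
      obtain ⟨l₄, h₄⟩ : ∃ l₄, l₂ ++ [v'] = n :: l₄ := by
        cases l₂ with
        | nil => simp at hn; exact ⟨[], by simp [hn.1]⟩
        | cons b l₂ => simp at hn; exact ⟨l₂ ++ [v'], by simp [hn.1]⟩
      rw [h₄] at hsub
      have hlast : (v' :: n :: l₄).getLast? = some v' := by
        rw [← h₄]; simp [List.getLast?_cons]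
      rcases transGen_of_not_blocked l₄ v' n hvn (hc.infix hsub) (fun h => hb (h.mono hsub)) hlast
        with h | ⟨z, hz', h⟩
      · exact hG _ h
      · exact hd z hz' h
    · exact hb ⟨a, v', n, hin, Or.inr ⟨⟨hav, hvn⟩, hz, hd⟩⟩

/-- An unblocked walk can be shortened to an unblocked path. -/
theorem exists_isPath_of_walk (hG : G.IsAcyclic) (p : List V) (h₁ : p.head? = some c)
    (h₂ : p.getLast? = some d) (hc : p.IsChain (fun a b => G.Adj a b ∨ G.Adj b a))
    (hb : ¬ G.Blocked Z p) : ∃ q, G.IsPath c d q ∧ ¬ G.Blocked Z q := by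
  induction hn : p.length using Nat.strong_induction_on generalizing p with
  | _ n ih =>
    by_cases hp : p.Nodup
    · exact ⟨p, ⟨h₁, h₂, hp, hc⟩, hb⟩
    · obtain ⟨v, hv⟩ := List.exists_duplicate_iff_not_nodup.2 hp
      rw [List.duplicate_iff_sublist] at hv
      obtain ⟨l₁, r, rfl, hv₂⟩ : ∃ l₁ r, p = l₁ ++ v :: r ∧ v ∈ r := by
        rw [List.cons_sublist_iff] at hv
        obtain ⟨r₁, r₂, rfl, hv₁, hv₂⟩ := hv
        obtain ⟨s, t, rfl⟩ := List.append_of_mem hv₁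
        refine ⟨s, t ++ r₂, by simp, ?_⟩
        simp at hv₂
        exact List.mem_append_right _ hv₂
      obtain ⟨l₂, l₃, rfl⟩ := List.append_of_mem hv₂
      refine ih _ ?_ (l₁ ++ v :: l₃) ?_ ?_ ?_ (not_blocked_erase_loop hG hc hb) rfl
      · rw [← hn]; simp
      · cases l₁ <;> simpa using h₁
      · simpa [List.getLast?_append, List.getLast?_cons] using h₂
      · rw [List.isChain_append] at hc ⊢
        obtain ⟨hc₁, hc₂, hc₃⟩ := hc
        refine ⟨hc₁, hc₂.infix ⟨v :: l₂, [], by simp⟩, ?_⟩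
        simpa using hc₃

/-- `G.Reach Z c b u`: there is a walk from `c` to `u` which is not blocked by `Z`; `b` is `false`
iff it arrives at `u` through an edge pointing towards `u`. -/
inductive Reach (G : Digraph V) (Z : Set V) (c : V) : Bool → V → Prop
  | start : Reach G Z c true c
  | parent {u w} : Reach G Z c true u → u ∉ Z → G.Adj w u → Reach G Z c true w
  | child {b u w} : Reach G Z c b u → u ∉ Z → G.Adj u w → Reach G Z c false w
  | collider {u w} : Reach G Z c false u → (u ∈ Z ∨ ∃ z ∈ Z, Relation.TransGen G.Adj u z) →
      G.Adj w u → Reach G Z c true w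

theorem IsAcyclic.asymm (hG : G.IsAcyclic) {u v : V} (h : G.Adj u v) : ¬ G.Adj v u :=
  fun h' => hG u (.tail (.single h) h')

theorem Reach.exists_walk (hG : G.IsAcyclic) {b : Bool} {u : V} (h : G.Reach Z c b u) :
    ∃ l : List V, (u :: l).getLast? = some c ∧
      (u :: l).IsChain (fun a b => G.Adj a b ∨ G.Adj b a) ∧ ¬ G.Blocked Z (u :: l) ∧
      ∀ n, l.head? = some n → if b then G.Adj u n else G.Adj n u := by
  -- Prepending `w` creates one new triple, centred at the old head `u`.
  have key : ∀ {u w : V} {l : List V}, ¬ G.Blocked Z (u :: l) →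
      (∀ n, l.head? = some n →
        ¬ (((G.Adj w u ∧ G.Adj u n) ∨ (G.Adj n u ∧ G.Adj u w) ∨ (G.Adj u w ∧ G.Adj u n)) ∧ u ∈ Z ∨
          (G.Adj w u ∧ G.Adj n u) ∧ u ∉ Z ∧ ∀ z ∈ Z, ¬ Relation.TransGen G.Adj u z)) →
      ¬ G.Blocked Z (w :: u :: l) := by
    rintro u w l hb hn ⟨a, v, e, hi, h⟩
    rw [List.infix_cons_iff] at hi
    rcases hi with hi | hi
    · match l, hi with
      | [], hi => simp at hi
      | n :: l, hi =>
        simp at hi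
        obtain ⟨rfl, rfl, rfl⟩ := hi
        exact hn _ rfl h
    · exact hb ⟨a, v, e, hi, h⟩
  induction h with
  | start =>
    refine ⟨[], by simp, by simp, ?_, by simp⟩
    rintro ⟨a, v, e, hi, h⟩
    have := hi.length_le
    simp at this
  | @parent u w _ hu hwu ih =>
    obtain ⟨l, h₁, h₂, h₃, h₄⟩ := ih
    refine ⟨u :: l, by simpa [List.getLast?_cons_cons] using h₁, ?_, key h₃ ?_, ?_⟩
    · exact List.isChain_cons_cons.2 ⟨Or.inl hwu, h₂⟩
    · intro n hn
      have := h₄ n hn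
      simp at this
      have := hG.asymm this
      tauto
    · rintro n hn
      simp at hn
      simpa [← hn] using hwu
  | @child b u w _ hu huw ih =>
    obtain ⟨l, h₁, h₂, h₃, h₄⟩ := ih
    refine ⟨u :: l, by simpa [List.getLast?_cons_cons] using h₁, ?_, key h₃ ?_, ?_⟩
    · exact List.isChain_cons_cons.2 ⟨Or.inr huw, h₂⟩
    · intro n hn
      have := hG.asymm huw
      tauto
    · rintro n hn
      simp at hn
      simpa [← hn] using huw
  | @collider u w _ hu hwu ih =>
    obtain ⟨l, h₁, h₂, h₃, h₄⟩ := ih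
    refine ⟨u :: l, by simpa [List.getLast?_cons_cons] using h₁, ?_, key h₃ ?_, ?_⟩
    · exact List.isChain_cons_cons.2 ⟨Or.inl hwu, h₂⟩
    · intro n hn
      have := h₄ n hn
      simp at this
      have h5 := hG.asymm this
      have h6 := hG.asymm hwu
      rintro (⟨h, -⟩ | ⟨-, h, h'⟩)
      · tauto
      · rcases hu with hu | ⟨z, hz, hu⟩
        · exact h hu
        · exact h' z hz hu
    · rintro n hn
      simp at hn
      simpa [← hn] using hwu

theorem DSep.not_reach (hG : G.IsAcyclic) (h : G.DSep {c} {d} Z) (b : Bool) :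
    ¬ G.Reach Z c b d := by
  intro hr
  obtain ⟨l, h₁, h₂, h₃, -⟩ := hr.exists_walk hG
  have hc : (d :: l).reverse.IsChain (fun a b => G.Adj a b ∨ G.Adj b a) := by
    rw [List.isChain_reverse]
    exact h₂.imp fun a b h => h.symm
  obtain ⟨q, hq, hb⟩ := exists_isPath_of_walk (d := d) hG (d :: l).reverse
    (by rw [List.head?_reverse]; exact h₁) (by simp) hc (fun h => h₃ (by simpa using h.reverse))
  exact hb (h c rfl d rfl q hq)

end Digraph

/-! ### Part: ancestral sets, connected nodes and wings. -/

namespace Digraph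

variable {V : Type*} {G : Digraph V}

/-- A set of nodes which contains the parents of all its members. -/
def IsAncestral (G : Digraph V) (U : Set V) : Prop :=
  ∀ v ∈ U, G.parents v ⊆ U

theorem isAncestral_setOf_reach (t : V) :
    G.IsAncestral {u | Relation.ReflTransGen G.Adj u t} :=
  fun _ hv _ hu => Relation.ReflTransGen.head hu hv

theorem IsAncestral.union {U W : Set V} (hU : G.IsAncestral U) (hW : G.IsAncestral W) :
    G.IsAncestral (U ∪ W) := by
  rintro v (hv | hv) u hu
  · exact Or.inl (hU v hv hu)
  · exact Or.inr (hW v hv hu)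

/-- The nodes which are connected to `a` given `x`. -/
def Conn (G : Digraph V) (a x : V) : Set V :=
  {u | ∃ b, G.Reach {x} a b u}

section Conn

variable {a b x y u v : V}

theorem mem_conn_child (hu : u ∈ G.Conn a x) (hux : u ≠ x) (h : G.Adj u v) : v ∈ G.Conn a x :=
  let ⟨_, hu⟩ := hu
  ⟨_, hu.child hux h⟩

/-- The nodes with a directed path to `x` or to `y`. -/
abbrev anc₂ (G : Digraph V) (x y : V) : Set V :=
  {u | Relation.ReflTransGen G.Adj u x} ∪ {u | Relation.ReflTransGen G.Adj u y}

/-- Connection passes to children away from the conditioning node. Both connections therefore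
descend along a directed path to `x` or `y`, where one of them is excluded. -/
theorem not_mem_conn_both (hx : x ∉ G.Conn b y) (hy : y ∉ G.Conn a x) (hu : u ∈ G.anc₂ x y)
    (ha : u ∈ G.Conn a x) (hb : u ∈ G.Conn b y) : False := by
  obtain ⟨t, ht, h⟩ : ∃ t, (t = x ∨ t = y) ∧ Relation.ReflTransGen G.Adj u t := by
    rcases hu with h | h
    · exact ⟨x, Or.inl rfl, h⟩
    · exact ⟨y, Or.inr rfl, h⟩
  induction h using Relation.ReflTransGen.head_induction_on with
  | refl => rcases ht with rfl | rfl <;> contradiction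
  | @head u v huv h ih =>
    have hux : u ≠ x := by rintro rfl; contradiction
    have huy : u ≠ y := by rintro rfl; contradiction
    have hv : v ∈ G.anc₂ x y := by
      rcases ht with rfl | rfl
      · exact Or.inl h
      · exact Or.inr h
    exact ih hv (mem_conn_child ha hux huv) (mem_conn_child hb huy huv)

/-- A directed path to `y` that missed `x` would carry the connection to `y`. The resulting path to
`x` is what opens colliders at `u`. -/
theorem transGen_of_mem_conn (hy : y ∉ G.Conn a x) (hu : u ∈ G.anc₂ x y) (ha : u ∈ G.Conn a x)
    (hux : u ≠ x) : Relation.TransGen G.Adj u x := by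
  rcases hu with h | h
  · exact (Relation.reflTransGen_iff_eq_or_transGen.1 h).resolve_left hux.symm
  · replace h : Relation.ReflTransGen G.Adj u y := h
    induction h using Relation.ReflTransGen.head_induction_on with
    | refl => contradiction
    | @head u v huv h ih =>
      by_cases hvx : v = x
      · exact .single (hvx ▸ huv)
      · exact .head huv (ih (mem_conn_child ha hux huv) hvx)

/-- If the walk enters `u` along an incoming edge, `u` is a collider opened by its descendant `x`;
otherwise it is a non-collider different from `x`. With `mem_conn_child` and `mem_conn_spouse`,
connection is closed under adjacency in the moral graph of `anc₂ x y`, except through `x`. -/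
theorem mem_conn_parent (hy : y ∉ G.Conn a x) (hu : u ∈ G.anc₂ x y) (ha : u ∈ G.Conn a x)
    (hux : u ≠ x) (h : G.Adj v u) : v ∈ G.Conn a x := by
  have ht := transGen_of_mem_conn hy hu ha hux
  obtain ⟨_ | _, ha⟩ := ha
  · exact ⟨_, ha.collider (Or.inr ⟨x, rfl, ht⟩) h⟩
  · exact ⟨_, ha.parent hux h⟩

theorem mem_conn_spouse (hy : y ∉ G.Conn a x) {w : V} (hw : w ∈ G.anc₂ x y) (ha : u ∈ G.Conn a x)
    (hux : u ≠ x) (huw : G.Adj u w) (hvw : G.Adj v w) : v ∈ G.Conn a x := by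
  by_cases hwx : w = x
  · obtain ⟨_, ha⟩ := ha
    exact ⟨_, (ha.child hux huw).collider (Or.inl hwx) hvw⟩
  · exact mem_conn_parent hy hw (mem_conn_child ha hux huw) hwx hvw

/-- The directed path is walked backwards from `a`; its nodes stay outside `anc₂ x y`, so `x` never
blocks it. -/
theorem reach_of_reflTransGen (hv : v ∉ G.anc₂ x y) (h : Relation.ReflTransGen G.Adj v a) :
    G.Reach {x} a true v := by
  induction h using Relation.ReflTransGen.head_induction_on with
  | refl => exact .start
  | @head v w hvw h ih =>
    have hw : w ∉ G.anc₂ x y := fun hw => hv (hw.imp (.head hvw) (.head hvw))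
    refine (ih hw).parent ?_ hvw
    rintro rfl
    exact hw (Or.inl .refl)

/-- A parent of a node outside `anc₂ x y` with a directed path to `a` is connected to `a`. -/
theorem mem_conn_of_adj (hv : v ∉ G.anc₂ x y) (h : Relation.ReflTransGen G.Adj v a)
    (huv : G.Adj u v) : u ∈ G.Conn a x := by
  refine ⟨_, (reach_of_reflTransGen hv h).parent ?_ huv⟩
  rintro rfl
  exact hv (Or.inl .refl)

/-- The common ancestors of `a` and `b` which are not ancestors of `x` or `y`. -/
def common (G : Digraph V) (a b x y : V) : Set V :=
  {u | Relation.ReflTransGen G.Adj u a ∧ Relation.ReflTransGen G.Adj u b ∧ u ∉ G.anc₂ x y}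

/-- The nodes which influence `a` but not `b` once `x`, `y` and the common ancestors are fixed. -/
def wing (G : Digraph V) (a b x y : V) : Set V :=
  {u | u ≠ x ∧ u ≠ y ∧ ((u ∉ G.anc₂ x y ∧ Relation.ReflTransGen G.Adj u a ∧
      ¬ Relation.ReflTransGen G.Adj u b) ∨ (u ∈ G.anc₂ x y ∧ u ∈ G.Conn a x))}

theorem anc₂_comm (x y : V) : G.anc₂ x y = G.anc₂ y x := Set.union_comm _ _

theorem common_comm (a b x y : V) : G.common a b x y = G.common b a y x := by
  ext u
  simp only [common, anc₂_comm x y, Set.mem_ofPred_eq]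
  tauto

theorem isAncestral_anc₂ (x y : V) : G.IsAncestral (G.anc₂ x y) :=
  (isAncestral_setOf_reach x).union (isAncestral_setOf_reach y)

theorem isAncestral_common (hx : x ∉ G.Conn b y) (hy : y ∉ G.Conn a x) :
    G.IsAncestral (G.common a b x y) := by
  rintro v ⟨hva, hvb, hv⟩ u hu
  refine ⟨.head hu hva, .head hu hvb, fun hu' => ?_⟩
  exact not_mem_conn_both hx hy hu' (mem_conn_of_adj hv hva hu)
    (mem_conn_of_adj (anc₂_comm x y ▸ hv) hvb hu)

theorem disjoint_common_anc₂ : Disjoint (G.common a b x y) (G.anc₂ x y) :=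
  Set.disjoint_left.2 fun _ h => h.2.2

theorem disjoint_wing_common : Disjoint (G.wing a b x y) (G.common a b x y) := by
  rw [Set.disjoint_left]
  rintro u ⟨-, -, h | h⟩ h'
  · exact h.2.2 h'.2.1
  · exact h'.2.2 h.1

theorem disjoint_wing_wing (hx : x ∉ G.Conn b y) (hy : y ∉ G.Conn a x) :
    Disjoint (G.wing a b x y) (G.wing b a y x) := by
  rw [Set.disjoint_left]
  rintro u ⟨-, -, h⟩ ⟨-, -, h'⟩
  rw [anc₂_comm y x] at h'
  have := @not_mem_conn_both V G a b x y u hx hy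
  tauto

/-- The outcome itself is a common ancestor when it influences `b` and is not an ancestor of a
setting. -/
theorem mem_wing_or_common (hax : a ≠ x) (hay : a ≠ y) :
    a ∈ G.wing a b x y ∪ G.common a b x y := by
  by_cases ha : a ∈ G.anc₂ x y
  · exact Or.inl ⟨hax, hay, Or.inr ⟨ha, _, .start⟩⟩
  · by_cases hb : Relation.ReflTransGen G.Adj a b
    · exact Or.inr ⟨.refl, hb, ha⟩
    · exact Or.inl ⟨hax, hay, Or.inl ⟨ha, .refl, hb⟩⟩

/-- The family of a node outside `anc₂ x y`. -/
theorem family_subset_of_notMem (hy : y ∉ G.Conn a x) (hv : v ∉ G.anc₂ x y)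
    (hva : Relation.ReflTransGen G.Adj v a) (hvb : ¬ Relation.ReflTransGen G.Adj v b) :
    insert v (G.parents v) ⊆ G.wing a b x y ∪ G.common a b x y ∪ {x} := by
  have hne : ∀ w, w ∉ G.anc₂ x y → w ≠ x ∧ w ≠ y := by
    refine fun w hw => ⟨?_, ?_⟩
    · rintro rfl; exact hw (Or.inl .refl)
    · rintro rfl; exact hw (Or.inr .refl)
  rintro u (rfl | hu)
  · exact Or.inl (Or.inl ⟨(hne u hv).1, (hne u hv).2, Or.inl ⟨hv, hva, hvb⟩⟩)
  · by_cases hux : u = x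
    · exact Or.inr hux
    refine Or.inl ?_
    have hc := mem_conn_of_adj hv hva hu
    by_cases hu' : u ∈ G.anc₂ x y
    · exact Or.inl ⟨hux, fun h => hy (h ▸ hc), Or.inr ⟨hu', hc⟩⟩
    · by_cases hub : Relation.ReflTransGen G.Adj u b
      · exact Or.inr ⟨.head hu hva, hub, hu'⟩
      · exact Or.inl ⟨hux, (hne u hu').2, Or.inl ⟨hu', .head hu hva, hub⟩⟩

/-- The family of a node of `anc₂ x y` which meets the wing of `a`. -/
theorem family_subset_of_mem (hy : y ∉ G.Conn a x) (hv : v ∈ G.anc₂ x y)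
    (hu : u ∈ insert v (G.parents v)) (huw : u ∈ G.wing a b x y) :
    insert v (G.parents v) ⊆ G.wing a b x y ∪ G.common a b x y ∪ {x} := by
  have hfam : insert v (G.parents v) ⊆ G.anc₂ x y :=
    Set.insert_subset hv (isAncestral_anc₂ x y v hv)
  obtain ⟨hux, huy, h⟩ := huw
  have huc : u ∈ G.Conn a x := by
    rcases h with h | h
    · exact absurd (hfam hu) h.1
    · exact h.2
  intro w hw
  by_cases hwx : w = x
  · exact Or.inr hwx
  have hwc : w ∈ G.Conn a x := by
    -- Two members of a family are equal, parent and child in either order, or both parents of `v`.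
    rcases hu with rfl | hu <;> rcases hw with rfl | hw
    · exact huc
    · exact mem_conn_parent hy hv huc hux hw
    · exact mem_conn_child huc hux hu
    · exact mem_conn_spouse hy hv huc hux hu hw
  exact Or.inl (Or.inl ⟨hwx, fun h => hy (h ▸ hwc), Or.inr ⟨hfam hw, hwc⟩⟩)

/-- Every family of ancestors of `a, b, x, y` lies in one of the two wings (together with the
common ancestors and the respective setting), or avoids both wings. -/
theorem family_cases (hx : x ∉ G.Conn b y) (hy : y ∉ G.Conn a x)
    (hv : v ∈ G.anc₂ x y ∪ G.anc₂ a b) :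
    insert v (G.parents v) ⊆ G.wing a b x y ∪ G.common a b x y ∪ {x} ∨
    insert v (G.parents v) ⊆ G.wing b a y x ∪ G.common a b x y ∪ {y} ∨
    Disjoint (insert v (G.parents v)) (G.wing a b x y ∪ G.wing b a y x) := by
  by_cases hv' : v ∈ G.anc₂ x y
  · by_cases h₁ : Disjoint (insert v (G.parents v)) (G.wing a b x y)
    · by_cases h₂ : Disjoint (insert v (G.parents v)) (G.wing b a y x)
      · exact Or.inr (Or.inr (Set.disjoint_union_right.2 ⟨h₁, h₂⟩))
      · obtain ⟨u, hu, hu'⟩ := Set.not_disjoint_iff.1 h₂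
        rw [common_comm a b x y]
        exact Or.inr (Or.inl (family_subset_of_mem hx (anc₂_comm x y ▸ hv') hu hu'))
    · obtain ⟨u, hu, hu'⟩ := Set.not_disjoint_iff.1 h₁
      exact Or.inl (family_subset_of_mem hy hv' hu hu')
  · have hv'' := hv.resolve_left hv'
    by_cases hva : Relation.ReflTransGen G.Adj v a
    · by_cases hvb : Relation.ReflTransGen G.Adj v b
      · have hvD : v ∈ G.common a b x y := ⟨hva, hvb, hv'⟩
        have := isAncestral_common hx hy v hvD
        left
        exact (Set.insert_subset hvD this).trans fun _ h => Or.inl (Or.inr h)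
      · exact Or.inl (family_subset_of_notMem hy hv' hva hvb)
    · have hvb : Relation.ReflTransGen G.Adj v b := hv''.resolve_left hva
      rw [common_comm a b x y]
      exact Or.inr (Or.inl (family_subset_of_notMem hx (anc₂_comm x y ▸ hv') hvb hva))

theorem wing_subset : G.wing a b x y ⊆ G.anc₂ x y ∪ G.anc₂ a b := by
  rintro u ⟨-, -, h | h⟩
  · exact Or.inr (Or.inl h.2.1)
  · exact Or.inl h.1

end Conn

end Digraph

/-! ### Part: marginals as sums over sets of coordinates. -/

section Marginals

variable {V : Type*} {α : V → Type*}

theorem cyl_inter_cyl (C D : Set V) (x : ∀ v, α v) : cyl C x ∩ cyl D x = cyl (C ∪ D) x := by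
  ext ω
  constructor
  · rintro ⟨h₁, h₂⟩ v (hv | hv)
    · exact h₁ v hv
    · exact h₂ v hv
  · exact fun h => ⟨fun v hv => h v (Or.inl hv), fun v hv => h v (Or.inr hv)⟩

theorem cyl_congr {C : Set V} {x y : ∀ v, α v} (h : ∀ v ∈ C, x v = y v) : cyl C x = cyl C y := by
  ext ω
  exact forall₂_congr fun v hv => by rw [h v hv]

theorem condProb_cyl (p : PMF (∀ v, α v)) (C D : Set V) (x : ∀ v, α v) :
    condProb p (cyl C x) (cyl D x) = prob p (cyl (C ∪ D) x) / prob p (cyl D x) := by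
  rw [condProb, cyl_inter_cyl]

theorem prob_mono {Ω : Type*} (p : PMF Ω) {E F : Set Ω} (h : E ⊆ F) : prob p E ≤ prob p F :=
  MeasureTheory.measure_mono h

theorem cyl_anti {C D : Set V} (h : C ⊆ D) (x : ∀ v, α v) : cyl D x ⊆ cyl C x :=
  fun _ hω v hv => hω v (h hv)

theorem prob_le_one {Ω : Type*} (p : PMF Ω) (E : Set Ω) : prob p E ≤ 1 :=
  (prob_mono p (Set.subset_univ E)).trans
    ((p.toOuterMeasure_apply_eq_one_iff _).2 (Set.subset_univ _)).le

theorem prob_ne_top {Ω : Type*} (p : PMF Ω) (E : Set Ω) : prob p E ≠ ⊤ :=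
  ((prob_le_one p E).trans_lt ENNReal.one_lt_top).ne

theorem prob_cyl_empty (p : PMF (∀ v, α v)) (x : ∀ v, α v) : prob p (cyl ∅ x) = 1 := by
  have : cyl ∅ x = Set.univ := by ext; simp [cyl]
  rw [this, prob, PMF.toOuterMeasure_apply_eq_one_iff]
  exact Set.subset_univ _

theorem prob_cyl_univ (p : PMF (∀ v, α v)) (x : ∀ v, α v) : prob p (cyl Set.univ x) = p x := by
  have : cyl Set.univ x = {x} := by ext; simp [cyl, funext_iff]
  rw [this, prob, PMF.toOuterMeasure_apply_singleton]

/-- The sum of `f` over all values of the coordinates in `s`. -/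
noncomputable def marg (s : Set V) (f : (∀ v, α v) → ℝ≥0∞) (x : ∀ v, α v) : ℝ≥0∞ :=
  ∑' ω, (cyl sᶜ x).indicator f ω

theorem prob_cyl_eq_marg (p : PMF (∀ v, α v)) (U : Set V) (x : ∀ v, α v) :
    prob p (cyl U x) = marg Uᶜ p x := by
  rw [prob, PMF.toOuterMeasure_apply, marg, compl_compl]

theorem marg_mono {s : Set V} {f g : (∀ v, α v) → ℝ≥0∞} (h : ∀ x, f x ≤ g x) (x : ∀ v, α v) :
    marg s f x ≤ marg s g x :=
  ENNReal.tsum_le_tsum fun ω => Set.indicator_le_indicator (h ω)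

theorem marg_empty (f : (∀ v, α v) → ℝ≥0∞) (x : ∀ v, α v) : marg ∅ f x = f x := by
  have : cyl (∅ᶜ) x = {x} := by ext; simp [cyl, funext_iff]
  rw [marg, this, tsum_eq_single x]
  · simp
  · intro y hy
    simp [hy]

theorem marg_marg {s t : Set V} (h : Disjoint s t) (f : (∀ v, α v) → ℝ≥0∞) (x : ∀ v, α v) :
    marg s (marg t f) x = marg (s ∪ t) f x := by
  classical
  have h₁ : ∀ ω, (cyl sᶜ x).indicator (marg t f) ω =
      ∑' η, (cyl sᶜ x).indicator (fun _ => (cyl tᶜ ω).indicator f η) ω := by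
    intro ω
    by_cases hω : ω ∈ cyl sᶜ x
    · simp [Set.indicator_of_mem hω, marg]
    · simp [Set.indicator_of_notMem hω]
  rw [marg, tsum_congr h₁, ENNReal.tsum_comm, marg]
  refine tsum_congr fun η => ?_
  -- For fixed `η`, the only possible intermediate configuration agrees with `η` on `s` and with `x`
  -- elsewhere.
  rw [tsum_eq_single (s.piecewise η x)]
  · have e₁ : s.piecewise η x ∈ cyl sᶜ x := fun v hv => Set.piecewise_eq_of_notMem _ _ _ hv
    rw [Set.indicator_of_mem e₁]
    have : η ∈ cyl tᶜ (s.piecewise η x) ↔ η ∈ cyl (s ∪ t)ᶜ x := by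
      constructor
      · intro hη v hv
        rw [Set.compl_union] at hv
        rw [hη v hv.2, Set.piecewise_eq_of_notMem _ _ _ hv.1]
      · intro hη v hv
        by_cases hvs : v ∈ s
        · rw [Set.piecewise_eq_of_mem _ _ _ hvs]
        · rw [Set.piecewise_eq_of_notMem _ _ _ hvs]
          exact hη v (by simp [hvs, hv.out])
    by_cases hη : η ∈ cyl (s ∪ t)ᶜ x
    · rw [Set.indicator_of_mem hη, Set.indicator_of_mem (this.2 hη)]
    · rw [Set.indicator_of_notMem hη, Set.indicator_of_notMem (mt this.1 hη)]
  · intro ω hω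
    by_contra hne
    have h₂ := Set.mem_of_indicator_ne_zero hne
    rw [Set.indicator_of_mem h₂] at hne
    have h₃ := Set.mem_of_indicator_ne_zero hne
    refine hω (funext fun v => ?_)
    by_cases hvs : v ∈ s
    · rw [Set.piecewise_eq_of_mem _ _ _ hvs]
      exact (h₃ v (Set.disjoint_left.1 h hvs)).symm
    · rw [Set.piecewise_eq_of_notMem _ _ _ hvs]
      exact h₂ v hvs

theorem marg_mul_left {s : Set V} {f g : (∀ v, α v) → ℝ≥0∞} {C : Set V} (hf : DependsOn f C)
    (hC : Disjoint C s) (x : ∀ v, α v) : marg s (fun y => f y * g y) x = f x * marg s g x := by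
  rw [marg, marg, ← ENNReal.tsum_mul_left]
  refine tsum_congr fun ω => ?_
  by_cases hω : ω ∈ cyl sᶜ x
  · rw [Set.indicator_of_mem hω, Set.indicator_of_mem hω,
      hf fun v hv => hω v (Set.disjoint_left.1 hC hv)]
  · rw [Set.indicator_of_notMem hω, Set.indicator_of_notMem hω, mul_zero]

theorem marg_mul_right {s : Set V} {f g : (∀ v, α v) → ℝ≥0∞} {C : Set V} (hg : DependsOn g C)
    (hC : Disjoint C s) (x : ∀ v, α v) : marg s (fun y => f y * g y) x = marg s f x * g x := by
  simp only [mul_comm _ (g _)]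
  exact marg_mul_left hg hC x

theorem DependsOn.marg {s C : Set V} {f : (∀ v, α v) → ℝ≥0∞} (hf : DependsOn f C) :
    DependsOn (marg s f) (C \ s) := by
  classical
  intro x y hxy
  have aux : ∀ {x ω : ∀ v, α v}, s.piecewise ω x ∈ cyl sᶜ x :=
    fun v hv => Set.piecewise_eq_of_notMem _ _ _ hv
  have inv : ∀ {x y ω : ∀ v, α v}, ω ∈ cyl sᶜ x → s.piecewise (s.piecewise ω y) x = ω := by
    intro x y ω hω
    funext v
    by_cases hv : v ∈ s
    · simp [hv]
    · simp [hv, hω v hv]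
  -- Replacing the coordinates outside `s` identifies the two fibres of summation.
  let e : cyl sᶜ x ≃ cyl sᶜ y :=
    { toFun := fun ω => ⟨s.piecewise ω.1 y, aux⟩
      invFun := fun ω => ⟨s.piecewise ω.1 x, aux⟩
      left_inv := fun ω => Subtype.ext (inv ω.2)
      right_inv := fun ω => Subtype.ext (inv ω.2) }
  rw [_root_.marg, _root_.marg, ← tsum_subtype, ← tsum_subtype, ← e.tsum_eq]
  refine tsum_congr fun ω => hf fun v hv => ?_
  change ω.1 v = s.piecewise ω.1 y v
  by_cases hvs : v ∈ s
  · simp [hvs]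
  · simp [hvs, ← hxy v ⟨hv, hvs⟩, ω.2 v hvs]

theorem dependsOn_prob_cyl (p : PMF (∀ v, α v)) (U : Set V) :
    DependsOn (fun x => prob p (cyl U x)) U :=
  fun x y h => by simp only [cyl_congr h]

theorem marg_prob_cyl (p : PMF (∀ v, α v)) {s U : Set V} (h : s ⊆ U) (x : ∀ v, α v) :
    marg s (fun y => prob p (cyl U y)) x = prob p (cyl (U \ s) x) := by
  simp only [prob_cyl_eq_marg]
  change marg s (marg Uᶜ p) x = _
  rw [marg_marg (Set.disjoint_compl_right_iff_subset.2 h), Set.sdiff_eq, Set.compl_inter,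
    compl_compl, Set.union_comm]

theorem DependsOn.mul' {C D : Set V} {f g : (∀ v, α v) → ℝ≥0∞} (hf : DependsOn f C)
    (hg : DependsOn g D) : DependsOn (fun x => f x * g x) (C ∪ D) := by
  intro x y h
  simp only
  rw [hf fun v hv => h v (Or.inl hv), hg fun v hv => h v (Or.inr hv)]

theorem DependsOn.mono' {C D : Set V} {f : (∀ v, α v) → ℝ≥0∞} (hf : DependsOn f C)
    (h : C ⊆ D) : DependsOn f D :=
  fun _ _ hxy => hf fun v hv => hxy v (h hv)

theorem dependsOn_prod {ι : Type*} (s : Finset ι) {f : ι → (∀ v, α v) → ℝ≥0∞} {C : Set V}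
    (hf : ∀ i ∈ s, DependsOn (f i) C) : DependsOn (fun x => ∏ i ∈ s, f i x) C :=
  fun _ _ h => Finset.prod_congr rfl fun i hi => hf i hi h

end Marginals

/-! ### Part: the Markov product restricted to ancestral sets. -/

namespace Digraph

variable {V : Type*} {α : V → Type*} {G : Digraph V} {p : PMF (∀ v, α v)}

/-- The conditional probability of a node given its parents. -/
noncomputable def kernel (G : Digraph V) (p : PMF (∀ v, α v)) (v : V) (x : ∀ v, α v) : ℝ≥0∞ :=
  condProb p (cyl {v} x) (cyl (G.parents v) x)

theorem dependsOn_kernel (v : V) : DependsOn (G.kernel p v) (insert v (G.parents v)) := by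
  intro x y h
  rw [kernel, kernel, cyl_congr (C := {v}) (x := x) (y := y),
    cyl_congr (C := G.parents v) (x := x) (y := y)]
  · exact fun w hw => h w (Or.inr hw)
  · rintro w rfl
    exact h w (Or.inl rfl)

/-- Equality fails where the parent values have probability zero: there the kernel is `0`. -/
theorem marg_kernel_le_one (hG : G.IsAcyclic) (v : V) (x : ∀ v, α v) :
    marg {v} (G.kernel p v) x ≤ 1 := by
  have hv : v ∉ G.parents v := fun h => hG v (.single h)
  have h₁ : G.kernel p v = fun y => prob p (cyl ({v} ∪ G.parents v) y) *
      (prob p (cyl (G.parents v) y))⁻¹ := by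
    funext y
    rw [kernel, condProb_cyl, div_eq_mul_inv]
  have h₂ : DependsOn (fun y => (prob p (cyl (G.parents v) y))⁻¹) (G.parents v) := by
    intro y z h
    simp only [cyl_congr h]
  rw [h₁, marg_mul_right h₂ (by simpa using hv), marg_prob_cyl p Set.subset_union_left,
    Set.union_sdiff_left, Set.sdiff_singleton_eq_self hv, ← div_eq_mul_inv]
  exact ENNReal.div_self_le_one

variable [Fintype V]

theorem exists_sink (hG : G.IsAcyclic) {s : Finset V} (hs : s.Nonempty) :
    ∃ v ∈ s, ∀ w ∈ s, ¬ G.Adj v w := by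
  have : Std.Irrefl (Function.swap (Relation.TransGen G.Adj)) := ⟨hG⟩
  have : IsTrans V (Function.swap (Relation.TransGen G.Adj)) :=
    ⟨fun a b c h₁ h₂ => Relation.TransGen.trans h₂ h₁⟩
  have hwf := Finite.wellFounded_of_trans_of_irrefl (Function.swap (Relation.TransGen G.Adj))
  obtain ⟨v, hv, h⟩ := hwf.has_min (s : Set V) hs
  exact ⟨v, hv, fun w hw hvw => h w hw (.single hvw)⟩

/-- A sink of `s` is summed out first: no other kernel in the product depends on its coordinate. -/
theorem marg_prod_kernel_le_one (hG : G.IsAcyclic) (s : Finset V) (x : ∀ v, α v) :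
    marg (s : Set V) (fun y => ∏ v ∈ s, G.kernel p v y) x ≤ 1 := by
  classical
  induction s using Finset.strongInduction generalizing x with
  | H s ih =>
    rcases s.eq_empty_or_nonempty with rfl | hs
    · simp [marg_empty]
    obtain ⟨v, hv, hsink⟩ := exists_sink hG hs
    have hset : (s : Set V) = ((s.erase v : Finset V) : Set V) ∪ {v} := by
      ext w
      by_cases h : w = v <;> simp [h, hv]
    have hd : Disjoint ((s.erase v : Finset V) : Set V) {v} := by simp
    rw [hset, ← marg_marg hd]
    refine le_trans (marg_mono (fun y => ?_) x) (ih _ (Finset.erase_ssubset hv) x)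
    simp only [← Finset.prod_erase_mul _ _ hv]
    have hdep : DependsOn (fun y => ∏ w ∈ s.erase v, G.kernel p w y) ({v}ᶜ) := by
      refine dependsOn_prod _ fun w hw => (dependsOn_kernel w).mono' ?_
      rw [Finset.mem_erase] at hw
      rintro u (rfl | hu)
      · exact hw.1
      · rintro rfl
        exact hsink w hw.2 hu
    rw [marg_mul_left hdep disjoint_compl_left]
    exact mul_le_of_le_one_right' (marg_kernel_le_one hG v y)

theorem Compatible.prob_cyl (hG : G.IsAcyclic) (hp : G.Compatible p) (U : Finset V)
    (hU : G.IsAncestral (U : Set V)) (x : ∀ v, α v) :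
    prob p (cyl (U : Set V) x) = ∏ v ∈ U, G.kernel p v x := by
  classical
  have hdep : DependsOn (fun y => ∏ v ∈ U, G.kernel p v y) (U : Set V) :=
    dependsOn_prod _ fun v hv =>
      (dependsOn_kernel v).mono' (Set.insert_subset hv (hU v hv))
  have hle : ∀ y, prob p (cyl (U : Set V) y) ≤ ∏ v ∈ U, G.kernel p v y := by
    intro y
    have h₁ : (p : (∀ v, α v) → ℝ≥0∞) =
        fun y => (∏ v ∈ U, G.kernel p v y) * ∏ v ∈ Uᶜ, G.kernel p v y := by
      funext y
      rw [Finset.prod_mul_prod_compl]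
      exact hp y
    rw [prob_cyl_eq_marg, h₁, marg_mul_left hdep disjoint_compl_right]
    refine mul_le_of_le_one_right' ?_
    rw [← Finset.coe_compl]
    exact marg_prod_kernel_le_one hG _ y
  -- Summed over the coordinates in `U`, the left side gives `1` and the right side at most `1`; a
  -- strict inequality at one point would contradict this.
  refine le_antisymm (hle x) (not_lt.1 fun hlt => ?_)
  have hsum : marg (U : Set V) (fun y => prob p (cyl (U : Set V) y)) x = 1 := by
    rw [marg_prob_cyl p subset_rfl, Set.sdiff_self, prob_cyl_empty]
  have hx : x ∈ cyl ((U : Set V)ᶜ) x := fun _ _ => rfl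
  refine absurd (marg_prod_kernel_le_one (p := p) hG U x) (not_le.2 ?_)
  rw [← hsum]
  refine ENNReal.tsum_lt_tsum (i := x) ?_ (fun ω => Set.indicator_le_indicator (hle ω)) ?_
  · exact (hsum.trans_lt ENNReal.one_lt_top).ne
  · rwa [Set.indicator_of_mem hx, Set.indicator_of_mem hx]

end Digraph

/-! ### Part: from a factorisation to local conditional probabilities. -/

section Wings

variable {V : Type*} {α : V → Type*} {p : PMF (∀ v, α v)}

/-- The quotient will be P(a | D, x); multiplying by it replaces the summed factor `f'` by `f`. -/
theorem ENNReal.wing_ratio {f f' h t : ℝ≥0∞} (hf : f' ≠ 0) (h0 : f' * h ≠ 0)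
    (ht : f' * h ≠ ⊤) : f' * t * (f * h / (f' * h)) = f * t := by
  have hh : h ≠ 0 := right_ne_zero_of_mul h0
  have hh' : h ≠ ⊤ := fun e => ht (by rw [e, ENNReal.mul_top hf])
  have hf' : f' ≠ ⊤ := fun e => ht (by rw [e, ENNReal.top_mul hh])
  rw [ENNReal.mul_div_mul_right _ _ hh hh', mul_comm f' t, mul_assoc, ENNReal.mul_div_cancel hf hf',
    mul_comm]

/-- One wing of a distribution which factorises given `D`, `x` and `y`. -/
theorem prob_wing {D K : Set V} {x y a b : V} {f g r : (∀ v, α v) → ℝ≥0∞}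
    (hK : K = D ∪ {x, y, a, b})
    (hxD : x ∉ D) (hyD : y ∉ D) (hxy : x ≠ y) (hax : a ≠ x) (hay : a ≠ y) (hbx : b ≠ x)
    (hby : b ≠ y) (hab : a ≠ b) (hf : DependsOn f (D ∪ {x, a})) (hg : DependsOn g (D ∪ {y, b}))
    (hr : DependsOn r (D ∪ {x, y})) (hp : ∀ ω, prob p (cyl K ω) = f ω * (g ω * r ω)) :
    ∃ h : (∀ v, α v) → ℝ≥0∞, ∀ ω,
      prob p (cyl (D ∪ {x, a}) ω) = f ω * h ω ∧
      prob p (cyl (D ∪ {x}) ω) = marg ({a} \ D) f ω * h ω ∧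
      prob p (cyl (D ∪ {x, y}) ω) =
        marg ({a} \ D) f ω * (marg ({b} \ D) g ω * r ω) := by
  -- Summation is over `{b} \ D` because `b` may lie in `D`, in which case nothing is summed.
  have hKb : ∀ ω, prob p (cyl (D ∪ {x, y, a}) ω) = f ω * (marg ({b} \ D) g ω * r ω) := by
    intro ω
    have e : D ∪ {x, y, a} = K \ ({b} \ D) := by
      rw [hK]; ext v
      simp only [Set.mem_union, Set.mem_insert_iff, Set.mem_singleton_iff, Set.mem_sdiff]
      constructor
      · rintro (h | rfl | rfl | rfl) <;> tauto
      · tauto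
    rw [e, ← marg_prob_cyl p (by rw [hK]; intro v; simp; tauto)]
    simp only [hp]
    rw [marg_mul_left hf, marg_mul_right hr]
    · rw [Set.disjoint_left]; rintro v (hv | rfl | rfl) <;> simp <;> tauto
    · rw [Set.disjoint_left]; rintro v (hv | rfl | rfl) <;> simp <;> tauto
  have hh : DependsOn (fun ω => marg ({b} \ D) g ω * r ω) (D ∪ {x, y}) := by
    refine (hg.marg.mul' hr).mono' ?_
    intro v; simp; tauto
  have hy₁ : ∀ ω, prob p (cyl (D ∪ {x, a}) ω) =
      f ω * marg {y} (fun ω => marg ({b} \ D) g ω * r ω) ω := by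
    intro ω
    have e : D ∪ {x, a} = (D ∪ {x, y, a}) \ {y} := by
      ext v
      simp only [Set.mem_union, Set.mem_insert_iff, Set.mem_singleton_iff, Set.mem_sdiff]
      constructor
      · rintro (h | rfl | rfl)
        · exact ⟨Or.inl h, fun e => hyD (e ▸ h)⟩
        · exact ⟨by tauto, hxy⟩
        · exact ⟨by tauto, hay⟩
      · tauto
    rw [e, ← marg_prob_cyl p (by simp)]
    simp only [hKb]
    rw [marg_mul_left hf]
    simp [hyD, hxy.symm, hay.symm]
  -- The witness `h` is the part without `f`, summed over `b` (unless in `D`) and `y`; it does not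
  -- depend on `a` unless `a ∈ D`.
  refine ⟨_, fun ω => ⟨hy₁ ω, ?_, ?_⟩⟩
  · have e : D ∪ {x} = (D ∪ {x, a}) \ ({a} \ D) := by
      ext v
      simp only [Set.mem_union, Set.mem_insert_iff, Set.mem_singleton_iff, Set.mem_sdiff]
      constructor
      · rintro (h | rfl) <;> tauto
      · tauto
    rw [e, ← marg_prob_cyl p (by intro v; simp; tauto)]
    simp only [hy₁]
    rw [marg_mul_right hh.marg]
    rw [Set.disjoint_left]; rintro v ⟨hv | rfl | rfl, -⟩ <;> simp <;> tauto
  · have e : D ∪ {x, y} = (D ∪ {x, y, a}) \ ({a} \ D) := by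
      ext v
      simp only [Set.mem_union, Set.mem_insert_iff, Set.mem_singleton_iff, Set.mem_sdiff]
      constructor
      · rintro (h | rfl | rfl) <;> tauto
      · tauto
    rw [e, ← marg_prob_cyl p (by intro v; simp; tauto)]
    simp only [hKb]
    rw [marg_mul_right hh]
    rw [Set.disjoint_left]; rintro v (hv | rfl | rfl) <;> simp <;> tauto

/-- A distribution which factorises given `D`, `x` and `y` is reproduced by local conditional
probabilities. -/
theorem prob_eq_mul_condProb {D : Set V} {x y a b : V} {f g r : (∀ v, α v) → ℝ≥0∞}
    (hxD : x ∉ D) (hyD : y ∉ D) (hxy : x ≠ y) (hax : a ≠ x) (hay : a ≠ y) (hbx : b ≠ x)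
    (hby : b ≠ y) (hab : a ≠ b) (hf : DependsOn f (D ∪ {x, a})) (hg : DependsOn g (D ∪ {y, b}))
    (hr : DependsOn r (D ∪ {x, y}))
    (hp : ∀ ω, prob p (cyl (D ∪ {x, y, a, b}) ω) = f ω * (g ω * r ω)) (ω : ∀ v, α v) :
    prob p (cyl (D ∪ {x, y, a, b}) ω) = prob p (cyl (D ∪ {x, y}) ω) *
      condProb p (cyl {a} ω) (cyl (D ∪ {x}) ω) * condProb p (cyl {b} ω) (cyl (D ∪ {y}) ω) := by
  obtain ⟨h, hA⟩ := prob_wing rfl hxD hyD hxy hax hay hbx hby hab hf hg hr hp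
  -- The same lemma with the two wings exchanged.
  obtain ⟨k, hB⟩ := prob_wing (K := D ∪ {x, y, a, b}) (f := g) (g := f) (r := r)
    (by ext v; simp; tauto) hyD hxD hxy.symm hby hbx hay hax hab.symm hg hf
    (hr.mono' (by intro v; simp; tauto)) (fun ω => by rw [hp]; ring)
  obtain ⟨hA₁, hA₂, hA₃⟩ := hA ω
  obtain ⟨hB₁, hB₂, -⟩ := hB ω
  by_cases h0 : prob p (cyl (D ∪ {x, y}) ω) = 0
  · rw [h0, zero_mul, zero_mul]
    refine le_antisymm (h0 ▸ prob_mono p (cyl_anti ?_ ω)) zero_le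
    intro v; simp; tauto
  have ne : ∀ {C : Set V}, C ⊆ D ∪ {x, y} → prob p (cyl C ω) ≠ 0 := fun hC h =>
    h0 (le_antisymm (h ▸ prob_mono p (cyl_anti hC ω)) zero_le)
  have hx0 := ne (C := D ∪ {x}) (by intro v; simp; tauto)
  have hy0 := ne (C := D ∪ {y}) (by intro v; simp; tauto)
  have hxt := prob_ne_top p (cyl (D ∪ {x}) ω)
  have hyt := prob_ne_top p (cyl (D ∪ {y}) ω)
  rw [condProb_cyl, condProb_cyl]
  rw [show ({a} ∪ (D ∪ {x}) : Set V) = D ∪ {x, a} by ext v; simp,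
    show ({b} ∪ (D ∪ {y}) : Set V) = D ∪ {y, b} by ext v; simp]
  rw [hA₁, hB₁, hA₃, hp]
  rw [hA₂] at hx0 hxt ⊢
  rw [hB₂] at hy0 hyt ⊢
  rw [ENNReal.wing_ratio (left_ne_zero_of_mul hx0) hx0 hxt, mul_assoc,
    ENNReal.wing_ratio (left_ne_zero_of_mul hy0) hy0 hyt]

end Wings

/-! ### Part: independence of disjoint ancestral sets and factorisation into wings. -/

namespace Digraph

variable {V : Type*} {α : V → Type*} {G : Digraph V} {p : PMF (∀ v, α v)} [Fintype V]

/-- Disjoint ancestral sets are independent. -/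
theorem Compatible.prob_cyl_union (hG : G.IsAcyclic) (hp : G.Compatible p) {D W T : Set V}
    (hD : G.IsAncestral D) (hW : G.IsAncestral W) (hDW : Disjoint D W) (hT : T ⊆ W)
    (x : ∀ v, α v) : prob p (cyl (D ∪ T) x) = prob p (cyl D x) * prob p (cyl T x) := by
  classical
  have h₁ : ∀ x, prob p (cyl (D ∪ W) x) = prob p (cyl D x) * prob p (cyl W x) := by
    intro x
    have e₁ := hp.prob_cyl hG D.toFinset (by simpa using hD) x
    have e₂ := hp.prob_cyl hG W.toFinset (by simpa using hW) x
    have e₃ := hp.prob_cyl hG (D.toFinset ∪ W.toFinset) (by simpa using hD.union hW) x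
    rw [Finset.prod_union (by simpa using hDW), ← e₁, ← e₂] at e₃
    simpa using e₃
  have e₁ : D ∪ T = (D ∪ W) \ (W \ T) := by
    ext v
    have := @Set.disjoint_left _ D W
    simp only [Set.mem_union, Set.mem_sdiff]
    constructor
    · rintro (h | h)
      · exact ⟨Or.inl h, fun h' => this.1 hDW h h'.1⟩
      · exact ⟨Or.inr (hT h), fun h' => h'.2 h⟩
    · tauto
  have e₂ : T = W \ (W \ T) := by rw [Set.sdiff_sdiff_cancel_left hT]
  rw [e₁, ← marg_prob_cyl p (Set.sdiff_subset.trans Set.subset_union_right)]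
  simp only [h₁]
  rw [marg_mul_left (dependsOn_prob_cyl p D) (hDW.mono_right Set.sdiff_subset),
    marg_prob_cyl p Set.sdiff_subset, ← e₂]

theorem sdiff_wings_eq {V : Type*} {U D NA NB : Set V} {x y a b : V} (hDU : D ⊆ U) (hAU : NA ⊆ U)
    (hBU : NB ⊆ U) (hxU : x ∈ U) (hyU : y ∈ U) (hAB : ∀ ⦃v⦄, v ∈ NA → v ∉ NB)
    (hAD : ∀ ⦃v⦄, v ∈ NA → v ∉ D) (hBD : ∀ ⦃v⦄, v ∈ NB → v ∉ D) (hxA : x ∉ NA) (hyA : y ∉ NA)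
    (hxB : x ∉ NB) (hyB : y ∉ NB) (ha : a ∈ NA ∪ D) (hb : b ∈ NB ∪ D) :
    D ∪ {x, y, a, b} =
      U \ ((NA \ {a}) ∪ ((NB \ {b}) ∪ U \ (NA ∪ NB ∪ D ∪ {x, y}))) := by
  ext v
  simp only [Set.mem_sdiff, Set.mem_union, Set.mem_insert_iff, Set.mem_singleton_iff] at ha hb ⊢
  have h₁ := @hDU v
  have h₂ := @hAU v
  have h₃ := @hBU v
  have h₄ := @hAB v
  have h₅ := @hAD v
  have h₆ := @hBD v
  clear hDU hAU hBU hAB hAD hBD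
  grind

/-- If the families of an ancestral set are separated into two wings and a rest, the distribution
factorises accordingly. -/
theorem Compatible.exists_factors (hG : G.IsAcyclic) (hp : G.Compatible p) {U D NA NB : Set V}
    {x y a b : V} (hU : G.IsAncestral U) (hDU : D ⊆ U) (hAU : NA ⊆ U) (hBU : NB ⊆ U)
    (hxU : x ∈ U) (hyU : y ∈ U) (hAB : Disjoint NA NB) (hAD : Disjoint NA D)
    (hBD : Disjoint NB D) (hxA : x ∉ NA) (hyA : y ∉ NA) (hxB : x ∉ NB) (hyB : y ∉ NB)
    (ha : a ∈ NA ∪ D) (hb : b ∈ NB ∪ D)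
    (hfam : ∀ v ∈ U, insert v (G.parents v) ⊆ NA ∪ D ∪ {x} ∨
      insert v (G.parents v) ⊆ NB ∪ D ∪ {y} ∨ Disjoint (insert v (G.parents v)) (NA ∪ NB)) :
    ∃ f g r : (∀ v, α v) → ℝ≥0∞, DependsOn f (D ∪ {x, a}) ∧ DependsOn g (D ∪ {y, b}) ∧
      DependsOn r (D ∪ {x, y}) ∧
      ∀ ω, prob p (cyl (D ∪ {x, y, a, b}) ω) = f ω * (g ω * r ω) := by
  classical
  -- A family inside `D` fits both wings; it is counted in the first.
  let IA := U.toFinset.filter fun v => insert v (G.parents v) ⊆ NA ∪ D ∪ {x}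
  let IA' := U.toFinset.filter fun v => ¬ insert v (G.parents v) ⊆ NA ∪ D ∪ {x}
  let IB := IA'.filter fun v => insert v (G.parents v) ⊆ NB ∪ D ∪ {y}
  let IR := IA'.filter fun v => ¬ insert v (G.parents v) ⊆ NB ∪ D ∪ {y}
  let F : (∀ v, α v) → ℝ≥0∞ := fun ω => ∏ v ∈ IA, G.kernel p v ω
  let H : (∀ v, α v) → ℝ≥0∞ := fun ω => ∏ v ∈ IB, G.kernel p v ω
  let R : (∀ v, α v) → ℝ≥0∞ := fun ω => ∏ v ∈ IR, G.kernel p v ω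
  have hF : DependsOn F (NA ∪ D ∪ {x}) := dependsOn_prod _ fun v hv =>
    (dependsOn_kernel v).mono' (Finset.mem_filter.1 hv).2
  have hH : DependsOn H (NB ∪ D ∪ {y}) := dependsOn_prod _ fun v hv =>
    (dependsOn_kernel v).mono' (Finset.mem_filter.1 hv).2
  have hR : DependsOn R (U \ (NA ∪ NB)) := dependsOn_prod _ fun v hv => by
    refine (dependsOn_kernel v).mono' ?_
    obtain ⟨hv, hvB⟩ := Finset.mem_filter.1 hv
    obtain ⟨hv, hvA⟩ := Finset.mem_filter.1 hv
    have hvU : v ∈ U := by simpa using hv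
    have := ((hfam v hvU).resolve_left hvA).resolve_left hvB
    exact Set.subset_sdiff.2 ⟨Set.insert_subset hvU (hU v hvU), this⟩
  have hprod : ∀ ω, prob p (cyl U ω) = F ω * (H ω * R ω) := by
    intro ω
    have := hp.prob_cyl hG U.toFinset (by simpa using hU) ω
    rw [Set.coe_toFinset] at this
    rw [this]
    simp only [F, H, R, IA, IB, IR, IA', Finset.prod_filter_mul_prod_filter_not]
  rw [Set.disjoint_left] at hAB hAD hBD
  let NR := U \ (NA ∪ NB ∪ D ∪ {x, y})
  have hR' : DependsOn (marg NR R) (D ∪ {x, y}) := hR.marg.mono' <| by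
    rintro v ⟨⟨h₁, h₂⟩, h₃⟩
    simp only [NR, Set.mem_sdiff, Set.mem_union, Set.mem_insert_iff, Set.mem_singleton_iff] at h₃ h₂ ⊢
    tauto
  have hH' : DependsOn (marg (NB \ {b}) H) (D ∪ {y, b}) := hH.marg.mono' <| by
    intro v; simp; tauto
  refine ⟨marg (NA \ {a}) F, marg (NB \ {b}) H, marg NR R, hF.marg.mono' ?_, hH', hR', fun ω => ?_⟩
  · intro v; simp; tauto
  have e : D ∪ {x, y, a, b} = U \ ((NA \ {a}) ∪ ((NB \ {b}) ∪ NR)) :=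
    sdiff_wings_eq hDU hAU hBU hxU hyU hAB hAD hBD hxA hyA hxB hyB ha hb
  have d₁ : Disjoint (NA \ {a}) ((NB \ {b}) ∪ NR) := by
    rw [Set.disjoint_left]
    rintro v ⟨hv, -⟩ (h | h)
    · exact hAB hv h.1
    · exact h.2 (Or.inl (Or.inl (Or.inl hv)))
  have d₂ : Disjoint (NB \ {b}) NR := by
    rw [Set.disjoint_left]
    rintro v ⟨hv, -⟩ h
    exact h.2 (Or.inl (Or.inl (Or.inr hv)))
  -- The sums run over `NR`, then `NB \ {b}`, then `NA \ {a}`; each affects only one of `R`, `H`,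
  -- `F`.
  rw [e, ← marg_prob_cyl p, ← marg_marg d₁]
  · have d₃ : Disjoint (NA ∪ D ∪ {x}) NR := by
      rw [Set.disjoint_left]
      rintro v ((hv | hv) | rfl) h <;> simp only [NR, Set.mem_sdiff, Set.mem_union,
        Set.mem_insert_iff, Set.mem_singleton_iff] at h <;> tauto
    have d₄ : Disjoint (NB ∪ D ∪ {y}) NR := by
      rw [Set.disjoint_left]
      rintro v ((hv | hv) | rfl) h <;> simp only [NR, Set.mem_sdiff, Set.mem_union,
        Set.mem_insert_iff, Set.mem_singleton_iff] at h <;> tauto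
    have d₅ : Disjoint (NA ∪ D ∪ {x}) (NB \ {b}) := by
      rw [Set.disjoint_left]
      rintro v ((hv | hv) | rfl) ⟨h, -⟩
      · exact hAB hv h
      · exact hBD h hv
      · exact hxB h
    have d₆ : Disjoint (D ∪ {x, y}) (NB \ {b}) := by
      rw [Set.disjoint_left]
      rintro v (hv | rfl | rfl) ⟨h, -⟩
      · exact hBD h hv
      · exact hxB h
      · exact hyB h
    have d₇ : Disjoint (D ∪ {y, b} ∪ (D ∪ {x, y})) (NA \ {a}) := by
      rw [Set.disjoint_left]
      rintro v ((hv | rfl | rfl) | (hv | rfl | rfl)) ⟨h, -⟩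
      · exact hAD h hv
      · exact hyA h
      · rcases hb with hb | hb
        · exact hAB h hb
        · exact hAD h hb
      · exact hAD h hv
      · exact hxA h
      · exact hyA h
    have e₁ : marg NR (fun ω => prob p (cyl U ω)) = fun ω => F ω * (H ω * marg NR R ω) := by
      funext ω
      simp only [hprod]
      rw [marg_mul_left hF d₃, marg_mul_left hH d₄]
    have e₂ : marg ((NB \ {b}) ∪ NR) (fun ω => prob p (cyl U ω)) =
        fun ω => F ω * (marg (NB \ {b}) H ω * marg NR R ω) := by
      funext ω
      rw [← marg_marg d₂, e₁, marg_mul_left hF d₅, marg_mul_right hR' d₆]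
    rw [e₂, marg_mul_right (hH'.mul' hR') d₇]
  · rintro v (h | h | h)
    · exact hAU h.1
    · exact hBU h.1
    · exact h.1

end Digraph

/-! ### Local hidden variable models as causal models with a single latent variable -/

/-- The edges of the causal structure in which each outcome is caused by its own setting and a
common latent variable, and the first setting may influence the second one. -/
inductive BellAdj : Obs ⊕ Unit → Obs ⊕ Unit → Prop
  | xy : BellAdj (.inl .X) (.inl .Y)
  | xa : BellAdj (.inl .X) (.inl .A)
  | yb : BellAdj (.inl .Y) (.inl .B)
  | la : BellAdj (.inr ()) (.inl .A)
  | lb : BellAdj (.inr ()) (.inl .B)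

/-- The causal structure with edges `BellAdj`. -/
def bellGraph : Digraph (Obs ⊕ Unit) := ⟨fun u v => BellAdj u v⟩

theorem bellGraph_isAcyclic : bellGraph.IsAcyclic := by
  let rank : Obs ⊕ Unit → ℕ := Sum.elim (fun o => Obs.rec 2 2 0 1 o) fun _ => 0
  intro v hv
  have h : ∀ u w, BellAdj u w → rank u < rank w := by
    rintro _ _ (_ | _ | _ | _ | _) <;> simp [rank]
  have := hv.lift (p := (· < ·)) rank h
  rw [Relation.transGen_eq_self] at this
  exact lt_irrefl _ this

theorem bellGraph_parents_A : bellGraph.parents (.inl .A) = {.inl .X, .inr ()} := by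
  ext w
  constructor
  · rintro (_ | _ | _ | _ | _) <;> simp
  · rintro (rfl | rfl)
    exacts [.xa, .la]

theorem bellGraph_parents_B : bellGraph.parents (.inl .B) = {.inl .Y, .inr ()} := by
  ext w
  constructor
  · rintro (_ | _ | _ | _ | _) <;> simp
  · rintro (rfl | rfl)
    exacts [.yb, .lb]

theorem bellGraph_parents_X : bellGraph.parents (.inl .X) = ∅ := by
  ext w
  constructor
  · rintro (_ | _ | _ | _ | _)
  · rintro ⟨⟩

theorem bellGraph_parents_Y : bellGraph.parents (.inl .Y) = {.inl .X} := by
  ext w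
  constructor
  · rintro (_ | _ | _ | _ | _); simp
  · rintro rfl
    exact .xy

theorem bellGraph_parents_latent : bellGraph.parents (.inr ()) = ∅ := by
  ext w
  constructor
  · rintro (_ | _ | _ | _ | _)
  · rintro ⟨⟩

theorem prod_obs {β : Type*} [CommMonoid β] (f : Obs → β) :
    ∏ v, f v = f .A * (f .B * (f .X * f .Y)) := by
  change ∏ v ∈ ({.A, .B, .X, .Y} : Finset Obs), f v = _
  simp

namespace CausalModel

variable {M O : Type u} {S : BinaryScenario M O} {P : Phenomenon S}

/-- The configuration given by values of the observable and of the latent variables. -/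
def combine {L : Type} {LV : L → Type u} (o : ∀ v, ObsVal M O v) (l : ∀ i, LV i) :
    ∀ v, NodeVal M O LV v
  | .inl v => o v
  | .inr i => l i

theorem obsEvent_eq_cyl (Γ : CausalModel P) (C : Set Obs) (o : ∀ v, ObsVal M O v)
    (l : ∀ i, Γ.LatentVal i) : Γ.obsEvent C o = cyl (Sum.inl '' C) (combine o l) := by
  ext ω
  constructor
  · rintro h _ ⟨v, hv, rfl⟩
    exact h v hv
  · exact fun h v hv => h _ ⟨v, hv, rfl⟩

theorem latentEvent_eq_cyl (Γ : CausalModel P) (o : ∀ v, ObsVal M O v)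
    (l : ∀ i, Γ.LatentVal i) : Γ.latentEvent l = cyl (Set.range Sum.inr) (combine o l) := by
  ext ω
  constructor
  · rintro h _ ⟨i, rfl⟩
    exact h i
  · exact fun h i => h _ ⟨i, rfl⟩

theorem prob_obsEvent_univ (Γ : CausalModel P) (o : ∀ v, ObsVal M O v) :
    prob Γ.joint (Γ.obsEvent Set.univ o) = ∑' l, Γ.joint (combine o l) := by
  let e : (∀ i, Γ.LatentVal i) ≃ Γ.obsEvent Set.univ o :=
    { toFun := fun l => ⟨combine o l, fun _ _ => rfl⟩
      invFun := fun ω i => ω.1 (.inr i)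
      left_inv := fun _ => rfl
      right_inv := fun ω => Subtype.ext <| by
        funext v
        rcases v with v | i
        · exact (ω.2 v trivial).symm
        · rfl }
  rw [prob, PMF.toOuterMeasure_apply, ← tsum_subtype, ← e.tsum_eq]
  rfl

end CausalModel

/-- A joint distribution of the observables and one latent variable which is independent of the
settings and screens off the two wings gives a factorisable causal model. -/
theorem ksNoncontextual_of_latent {M O : Type u} {S : BinaryScenario M O} {P : Phenomenon S}
    {LV : Unit → Type u} (q : PMF (∀ v, NodeVal M O LV v))
    (hq : q.map (fun ω v => ω (Sum.inl v)) = P.dist)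
    (hind : ∀ x, prob q (cyl {.inl .X, .inl .Y, .inr ()} x) =
      prob q (cyl {.inl .X, .inl .Y} x) * prob q (cyl {.inr ()} x))
    (hloc : ∀ x, q x = prob q (cyl {.inl .X, .inl .Y, .inr ()} x) *
      condProb q (cyl {.inl .A} x) (cyl {.inl .X, .inr ()} x) *
      condProb q (cyl {.inl .B} x) (cyl {.inl .Y, .inr ()} x)) : P.KSNoncontextual := by
  have hcomp : bellGraph.Compatible q := by
    intro x
    have hxy : condProb q (cyl {.inl .X} x) (cyl ∅ x) *
        condProb q (cyl {.inl .Y} x) (cyl {.inl .X} x) = prob q (cyl {.inl .X, .inl .Y} x) := by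
      rw [condProb_cyl, condProb_cyl, prob_cyl_empty, div_one, Set.union_empty,
        Set.singleton_union, Set.pair_comm]
      -- If P(X) vanishes at this value, so does P(X,Y).
      refine ENNReal.mul_div_cancel' (fun h => ?_) (fun h => absurd h (prob_ne_top _ _))
      exact le_antisymm (h ▸ prob_mono q (cyl_anti (by simp) x)) zero_le
    rw [Fintype.prod_sum_type, prod_obs]
    simp only [Finset.univ_unique, Finset.prod_singleton, PUnit.default_eq_unit,
      bellGraph_parents_A, bellGraph_parents_B, bellGraph_parents_X, bellGraph_parents_Y,
      bellGraph_parents_latent]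
    rw [hxy, condProb_cyl q {.inr ()}, prob_cyl_empty, div_one, Set.union_empty, hloc, hind]
    ring
  let Γ : CausalModel P :=
    { Latent := Unit
      LatentVal := LV
      graph := bellGraph
      acyclic := bellGraph_isAcyclic
      joint := q
      compatible := hcomp
      marginal := hq }
  refine ⟨Γ, fun o ho => ?_⟩
  have hall : Γ.obsEvent {.A, .B} o ∩ Γ.obsEvent {.X, .Y} o = Γ.obsEvent Set.univ o := by
    ext ω
    constructor
    · rintro ⟨h₁, h₂⟩ (_ | _ | _ | _) -
      exacts [h₁ _ (by simp), h₁ _ (by simp), h₂ _ (by simp), h₂ _ (by simp)]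
    · exact fun h => ⟨fun v _ => h v trivial, fun v _ => h v trivial⟩
  rw [condProb, hall, Γ.prob_obsEvent_univ, div_eq_mul_inv, ← ENNReal.tsum_mul_right]
  refine tsum_congr fun l => ?_
  rw [Γ.obsEvent_eq_cyl _ o l] at ho ⊢
  rw [Γ.obsEvent_eq_cyl _ o l, Γ.obsEvent_eq_cyl _ o l, Γ.obsEvent_eq_cyl _ o l,
    Γ.obsEvent_eq_cyl _ o l, Γ.latentEvent_eq_cyl o l, cyl_inter_cyl, cyl_inter_cyl]
  have hr : (Set.range Sum.inr : Set (Obs ⊕ Unit)) = {.inr ()} := by ext (v | v) <;> simp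
  change prob q _ ≠ 0 at ho
  change q _ * (prob q _)⁻¹ = prob q (cyl (Set.range (Sum.inr : Unit → Obs ⊕ Unit)) _) *
    condProb q _ (cyl (_ ∪ (Set.range (Sum.inr : Unit → Obs ⊕ Unit))) _) *
    condProb q _ (cyl (_ ∪ (Set.range (Sum.inr : Unit → Obs ⊕ Unit))) _)
  simp only [hr, Set.image_singleton, Set.image_pair, Set.singleton_union] at ho ⊢
  rw [hloc, hind, mul_right_comm _ _ (_)⁻¹, mul_right_comm _ _ (_)⁻¹, mul_right_comm _ _ (_)⁻¹,
    ENNReal.mul_inv_cancel ho (prob_ne_top _ _), one_mul]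

/-! ### Part: gathering `D` into one latent variable. -/

namespace CausalModel

variable {M O : Type u} {L : Type} {LV : L → Type u}

/-- Keep the observable variables and gather the nodes of `D` in one latent variable. -/
def gather (D : Set (Obs ⊕ L)) (ω : ∀ v, NodeVal M O LV v) :
    ∀ v, NodeVal M O (fun _ : Unit => ∀ d : D, NodeVal M O LV d) v
  | .inl v => ω (.inl v)
  | .inr _ => fun d => ω d

theorem gather_mem_cyl {D : Set (Obs ⊕ L)} {C : Set Obs} (ω η : ∀ v, NodeVal M O LV v) :
    gather D η ∈ cyl (Sum.inl '' C) (gather D ω) ↔ η ∈ cyl (Sum.inl '' C) ω := by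
  constructor
  · rintro h _ ⟨v, hv, rfl⟩
    exact h _ ⟨v, hv, rfl⟩
  · rintro h _ ⟨v, hv, rfl⟩
    exact h _ ⟨v, hv, rfl⟩

theorem gather_mem_cyl_latent {D : Set (Obs ⊕ L)} (ω η : ∀ v, NodeVal M O LV v) :
    gather D η ∈ cyl {.inr ()} (gather D ω) ↔ η ∈ cyl D ω := by
  constructor
  · intro h d hd
    exact congrFun (h _ rfl) ⟨d, hd⟩
  · rintro h _ rfl
    exact funext fun d => h d d.2

theorem prob_gather (p : PMF (∀ v, NodeVal M O LV v)) {D : Set (Obs ⊕ L)} (C : Set Obs)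
    (ω : ∀ v, NodeVal M O LV v) :
    prob (p.map (gather D)) (cyl (Sum.inl '' C) (gather D ω)) = prob p (cyl (Sum.inl '' C) ω) := by
  rw [prob, PMF.toOuterMeasure_map_apply, prob]
  congr 1
  ext η
  exact gather_mem_cyl ω η

theorem prob_gather_latent (p : PMF (∀ v, NodeVal M O LV v)) {D : Set (Obs ⊕ L)} (C : Set Obs)
    (ω : ∀ v, NodeVal M O LV v) :
    prob (p.map (gather D)) (cyl (Sum.inl '' C ∪ {.inr ()}) (gather D ω)) =
      prob p (cyl (D ∪ Sum.inl '' C) ω) := by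
  rw [prob, PMF.toOuterMeasure_map_apply, prob]
  congr 1
  ext η
  rw [Set.mem_preimage, ← cyl_inter_cyl, Set.union_comm D, ← cyl_inter_cyl]
  exact and_congr (gather_mem_cyl ω η) (gather_mem_cyl_latent ω η)

/-- A value of the observables and the gathered variable comes from a configuration, up to
the values of the observables in `D`. -/
theorem exists_gather (p : PMF (∀ v, NodeVal M O LV v)) (D : Set (Obs ⊕ L))
    (x : ∀ v, NodeVal M O (fun _ : Unit => ∀ d : D, NodeVal M O LV d) v) :
    ∃ ω : ∀ v, NodeVal M O LV v, gather D ω (.inr ()) = x (.inr ()) ∧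
      ∀ v, Sum.inl v ∉ D → gather D ω (.inl v) = x (.inl v) := by
  classical
  -- Only supplies arbitrary values for the latent nodes outside `D`.
  obtain ⟨ω₀, -⟩ := p.support_nonempty
  refine ⟨fun v => if h : v ∈ D then x (.inr ()) ⟨v, h⟩ else
    match v with
    | .inl v => x (.inl v)
    | .inr i => ω₀ (.inr i), ?_, fun v hv => ?_⟩
  · funext d
    simp [gather]
  · exact dif_neg hv

/-- If the gathered variable contradicts the value of an observable, the event is impossible. -/
theorem prob_gather_eq_zero (p : PMF (∀ v, NodeVal M O LV v)) {D : Set (Obs ⊕ L)}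
    {x : ∀ v, NodeVal M O (fun _ : Unit => ∀ d : D, NodeVal M O LV d) v}
    {ω : ∀ v, NodeVal M O LV v} (hω : gather D ω (.inr ()) = x (.inr ())) {v : Obs}
    (hv : Sum.inl v ∈ D) (hne : gather D ω (.inl v) ≠ x (.inl v)) {C : Set (Obs ⊕ Unit)}
    (hC : {.inl v, .inr ()} ⊆ C) : prob (p.map (gather D)) (cyl C x) = 0 := by
  rw [prob, PMF.toOuterMeasure_map_apply]
  have : gather D ⁻¹' cyl C x = ∅ := by
    rw [Set.eq_empty_iff_forall_notMem]
    intro η hη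
    have h₁ : η (.inl v) = x (.inl v) := hη (.inl v) (hC (by simp))
    have h₂ : gather D η (.inr ()) = x (.inr ()) := hη (.inr ()) (hC (by simp))
    rw [← hω] at h₂
    exact hne ((congrFun h₂ ⟨_, hv⟩).symm.trans h₁)
  rw [this]
  exact MeasureTheory.measure_empty

end CausalModel

/-! ### Part: assembling the Bell model. -/

open CausalModel in
theorem theorem1 {M O : Type u} {S : BinaryScenario M O} (P : Phenomenon S)
    (hP : P.NoDisturbance) (Γ : CausalModel P) (hΓ : Γ.Faithful) :
    P.KSNoncontextual := by
  have hG := Γ.acyclic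
  have hY : (.inl .Y) ∉ Γ.graph.Conn (.inl .A) (.inl .X) := by
    have h : CondIndep P.dist {.A} {.Y} {.X} := by
      intro o ho
      rw [Set.singleton_union, Set.pair_comm] at ho ⊢
      exact (hP o ho).1
    have := hΓ {.A} {.Y} {.X} (by simp) (by simp) (by simp) h
    simp only [Set.image_singleton] at this
    rintro ⟨b, hb⟩
    exact this.not_reach hG b hb
  have hX : (.inl .X) ∉ Γ.graph.Conn (.inl .B) (.inl .Y) := by
    have h : CondIndep P.dist {.B} {.X} {.Y} := by
      intro o ho
      rw [Set.singleton_union] at ho ⊢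
      exact (hP o ho).2
    have := hΓ {.B} {.X} {.Y} (by simp) (by simp) (by simp) h
    simp only [Set.image_singleton] at this
    rintro ⟨b, hb⟩
    exact this.not_reach hG b hb
  set D := Γ.graph.common (.inl .A) (.inl .B) (.inl .X) (.inl .Y) with hD
  have hDX : (.inl .X) ∉ D := fun h => h.2.2 (Or.inl .refl)
  have hDY : (.inl .Y) ∉ D := fun h => h.2.2 (Or.inr .refl)
  have hind : ∀ ω, prob Γ.joint (cyl (D ∪ {.inl .X, .inl .Y}) ω) =
      prob Γ.joint (cyl D ω) * prob Γ.joint (cyl {.inl .X, .inl .Y} ω) :=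
    Γ.compatible.prob_cyl_union hG (Digraph.isAncestral_common hX hY)
      (Digraph.isAncestral_anc₂ _ _) Digraph.disjoint_common_anc₂ <| by
        rintro _ (rfl | rfl)
        exacts [Or.inl .refl, Or.inr .refl]
  have hloc : ∀ ω, prob Γ.joint (cyl (D ∪ {.inl .X, .inl .Y, .inl .A, .inl .B}) ω) =
      prob Γ.joint (cyl (D ∪ {.inl .X, .inl .Y}) ω) *
        condProb Γ.joint (cyl {.inl .A} ω) (cyl (D ∪ {.inl .X}) ω) *
        condProb Γ.joint (cyl {.inl .B} ω) (cyl (D ∪ {.inl .Y}) ω) := by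
    have hw : Γ.graph.wing (.inl .B) (.inl .A) (.inl .Y) (.inl .X) ⊆
        Γ.graph.anc₂ (.inl .X) (.inl .Y) ∪ Γ.graph.anc₂ (.inl .A) (.inl .B) := by
      rw [Digraph.anc₂_comm (Sum.inl Obs.X), Digraph.anc₂_comm (Sum.inl Obs.A)]
      exact Digraph.wing_subset
    -- `U` consists of all ancestors of the four observables.
    obtain ⟨f, g, r, hf, hg, hr, hfac⟩ := Γ.compatible.exists_factors hG (D := D)
      (a := .inl .A) (b := .inl .B) (x := .inl .X) (y := .inl .Y)
      (U := Γ.graph.anc₂ (.inl .X) (.inl .Y) ∪ Γ.graph.anc₂ (.inl .A) (.inl .B))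
      ((Digraph.isAncestral_anc₂ _ _).union (Digraph.isAncestral_anc₂ _ _))
      (fun v hv => Or.inr (Or.inl hv.1))
      Digraph.wing_subset hw (Or.inl (Or.inl .refl)) (Or.inl (Or.inr .refl))
      (Digraph.disjoint_wing_wing hX hY) Digraph.disjoint_wing_common
      (by rw [hD, Digraph.common_comm]; exact Digraph.disjoint_wing_common)
      (fun h => h.1 rfl) (fun h => h.2.1 rfl) (fun h => h.2.1 rfl) (fun h => h.1 rfl)
      (Digraph.mem_wing_or_common (by simp) (by simp))
      (by rw [hD, Digraph.common_comm]; exact Digraph.mem_wing_or_common (by simp) (by simp))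
      (fun v hv => Digraph.family_cases hX hY hv)
    exact prob_eq_mul_condProb hDX hDY (by simp) (by simp) (by simp) (by simp) (by simp) (by simp)
      hf hg hr hfac
  refine ksNoncontextual_of_latent (Γ.joint.map (gather D)) ?_ (fun x => ?_) fun x => ?_
  · rw [PMF.map_comp, ← Γ.marginal]
    rfl
  · obtain ⟨ω, h₁, h₂⟩ := exists_gather Γ.joint D x
    have hc : ∀ C : Set (Obs ⊕ Unit), C ⊆ {.inl .X, .inl .Y, .inr ()} →
        cyl C x = cyl C (gather D ω) := by
      refine fun C hC => cyl_congr fun v hv => ?_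
      rcases hC hv with rfl | rfl | rfl
      exacts [(h₂ _ hDX).symm, (h₂ _ hDY).symm, h₁.symm]
    rw [hc _ subset_rfl, hc {.inl .X, .inl .Y} (by intro v; simp; tauto),
      hc {.inr ()} (by simp)]
    have e₁ := prob_gather_latent Γ.joint (D := D) {.X, .Y} ω
    have e₂ := prob_gather Γ.joint (D := D) {.X, .Y} ω
    have e₃ := prob_gather_latent Γ.joint (D := D) ∅ ω
    simp only [Set.image_pair, Set.image_empty, Set.empty_union, Set.union_empty,
      Set.insert_union, Set.singleton_union] at e₁ e₂ e₃
    rw [e₁, e₂, e₃, hind, mul_comm]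
  · obtain ⟨ω, h₁, h₂⟩ := exists_gather Γ.joint D x
    rw [← prob_cyl_univ (Γ.joint.map (gather D)) x, condProb_cyl, condProb_cyl]
    -- The values of A and B in `x` may contradict their copies in the latent value. Then the
    -- outcome lies in `D` and both sides vanish.
    by_cases hA : gather D ω (.inl .A) = x (.inl .A)
    · by_cases hB : gather D ω (.inl .B) = x (.inl .B)
      · have hx : gather D ω = x := by
          funext v
          rcases v with (_ | _ | _ | _) | _
          exacts [hA, hB, h₂ _ hDX, h₂ _ hDY, h₁]
        subst hx
        have e₁ := prob_gather_latent Γ.joint (D := D) {.X, .Y, .A, .B} ω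
        have e₂ := prob_gather_latent Γ.joint (D := D) {.X, .Y} ω
        have e₃ := prob_gather_latent Γ.joint (D := D) {.A, .X} ω
        have e₄ := prob_gather_latent Γ.joint (D := D) {.X} ω
        have e₅ := prob_gather_latent Γ.joint (D := D) {.B, .Y} ω
        have e₆ := prob_gather_latent Γ.joint (D := D) {.Y} ω
        have hu : (Sum.inl '' {.X, .Y, .A, .B} ∪ {.inr ()} : Set (Obs ⊕ Unit)) = Set.univ := by
          ext ((_ | _ | _ | _) | _) <;> simp
        rw [hu] at e₁
        simp only [Set.image_singleton, Set.image_insert_eq,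
          Set.insert_union, Set.singleton_union] at e₁ e₂ e₃ e₄ e₅ e₆ ⊢
        rw [e₁, e₂, e₃, e₄, e₅, e₆, hloc, condProb_cyl, condProb_cyl, Set.union_left_comm {Sum.inl Obs.A},
          Set.union_left_comm {Sum.inl Obs.B}, Set.singleton_union, Set.singleton_union]
      · have hBD : (.inl .B) ∈ D := by_contra fun h => hB (h₂ _ h)
        rw [prob_gather_eq_zero Γ.joint h₁ hBD hB (Set.subset_univ _),
          prob_gather_eq_zero Γ.joint h₁ hBD hB (C := {.inl .B} ∪ {.inl .Y, .inr ()})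
            (by intro v; simp; tauto), ENNReal.zero_div, mul_zero]
    · have hAD : (.inl .A) ∈ D := by_contra fun h => hA (h₂ _ h)
      rw [prob_gather_eq_zero Γ.joint h₁ hAD hA (Set.subset_univ _),
        prob_gather_eq_zero Γ.joint h₁ hAD hA (C := {.inl .A} ∪ {.inl .X, .inr ()})
          (by intro v; simp; tauto), ENNReal.zero_div, mul_zero, zero_mul]
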